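/- Let $k$ be any field. A regular $k$-curve is an integral, separated scheme of finite type over $k$ whose local rings at closed points are discrete valuation rings. A Galois cover of regular $k$-curves is a finite dominant $k$-morphism whose extension of function fields is Galois; it is a $G$-cover if $G$ is the Galois group. Write $\operatorname{QF}$ for the field of fractions, $k(\cdot)$ for residue fields, and $\hat{\mathcal O}$ for completed local rings. For a closed point $\tau_x$ of $X$, the decomposition group at $\tau_x$ of a Galois cover $X\to Y$ is the stabilizer of $\mathcal O_{X,\tau_x}$ in the Galois group, and the inertia group is its subgroup acting trivially on $k(\tau_x)$. Let $\Phi:X\to Y$ be a $G$-cover of regular $k$-curves, $\tau_x\in X$ a closed point, and $\tau=\Phi(\tau_x)$. Let $G_\tau$ and $I_\tau$ be the decomposition and inertia groups of $\Phi$ at $\tau_x$, and let $N\le I_\tau$ be a normal subgroup of $G_\tau$. Let $\Psi:Z\to Y$ be a Galois cover of regular $k$-curves and $\tau_z\in Z$ a closed point with $\Psi(\tau_z)=\tau$ and $k(\tau_z)=k(\tau)$. Let $k(\tau)\subset\hat{\mathcal O}_{Y,\tau}$ and $k(\tau_x)\subset\hat{\mathcal O}_{X,\tau_x}$ be compatible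 coefficient fields, that is, ring-theoretic sections of the reduction maps that commute with $k(\tau)\to k(\tau_x)$ and $\hat{\mathcal O}_{Y,\tau}\to\hat{\mathcal O}_{X,\tau_x}$. Suppose that, for an embedding of $\operatorname{QF}(\hat{\mathcal O}_{Z,\tau_z})$ into $\operatorname{QF}(\hat{\mathcal O}_{X,\tau_x})$ over $\operatorname{QF}(\hat{\mathcal O}_{Y,\tau})$, $$\operatorname{QF}(\hat{\mathcal O}_{X,\tau_x})^N=\operatorname{QF}(\hat{\mathcal O}_{Z,\tau_z})\,k(\tau_x)$$ as subfields of $\operatorname{QF}(\hat{\mathcal O}_{X,\tau_x})$. Let $W$ be an irreducible component of the normalization of $X\times_Y Z$ which dominates $Y$, and let $\tau_w\in W$ be a closed point lying above $\tau_x$ and $\tau_z$. Then $W$ is a regular curve and $W\to Z$ is a Galois cover. Let $D$ and $I$ be its decomposition and inertia groups at $\tau_w$. Restriction to $k(X)$ maps $I$ isomorphically onto $N$, and there is an exact sequence $$1\to N\to D\to \operatorname{Gal}(k(\tau_x)/k(\tau))\to 1$$ in which the image of $N$ is $I$, the map $N\to I$ is the inverse of the restriction isomorphism, and the map $D\to\operatorname{Gal}(k(\tau_x)/k(\tau))$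 is induced by the action of $D$ on the residue field $k(\tau_w)\supseteq k(\tau_x)$. -/

import Mathlib

open CategoryTheory CategoryTheory.Limits AlgebraicGeometry

universe u

noncomputable section

namespace CoverInertia

/-! ### Completed local rings -/

section Completion

/-- The completed local ring `R̂ = lim R / 𝔪ⁿ` of a local ring `R`. -/
abbrev CompletedRing (R : Type u) [CommRing R] [IsLocalRing R] : Type u :=
  AdicCompletion (IsLocalRing.maximalIdeal R) R

/-- The reduction `R̂ → R / 𝔪` to the residue field. -/
def completedResidue (R : Type u) [CommRing R] [IsLocalRing R] :
    CompletedRing R →+* IsLocalRing.ResidueField R :=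
  (AdicCompletion.evalOneₐ (IsLocalRing.maximalIdeal R)).toRingHom

section Functoriality

variable {R S T : Type u} [CommRing R] [IsLocalRing R] [CommRing S] [IsLocalRing S]
  [CommRing T] [IsLocalRing T]

lemma maximalIdeal_pow_le_comap (f : R →+* S) [IsLocalHom f] (n : ℕ) :
    IsLocalRing.maximalIdeal R ^ n ≤ (IsLocalRing.maximalIdeal S ^ n).comap f := by
  refine le_trans ?_ (Ideal.le_comap_pow f n)
  exact Ideal.pow_right_mono (((IsLocalRing.local_hom_TFAE f).out 0 3).mp ‹_›) n

/-- The map `R / 𝔪ⁿ → S / 𝔫ⁿ` induced by a local homomorphism `R → S`. -/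
def quotientPowMap (f : R →+* S) [IsLocalHom f] (n : ℕ) :
    R ⧸ IsLocalRing.maximalIdeal R ^ n →+* S ⧸ IsLocalRing.maximalIdeal S ^ n :=
  Ideal.quotientMap _ f (maximalIdeal_pow_le_comap f n)

lemma factorPow_quotientPowMap (f : R →+* S) [IsLocalHom f] {m n : ℕ} (hmn : m ≤ n) :
    (Ideal.Quotient.factorPow (IsLocalRing.maximalIdeal S) hmn).comp ((quotientPowMap f n).comp
      (AdicCompletion.evalₐ (IsLocalRing.maximalIdeal R) n).toRingHom) =
    (quotientPowMap f m).comp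
      (AdicCompletion.evalₐ (IsLocalRing.maximalIdeal R) m).toRingHom := by
  ext x
  obtain ⟨x, rfl⟩ := AdicCompletion.mk_surjective _ _ x
  have h := AdicCompletion.Ideal.mk_eq_mk (IsLocalRing.maximalIdeal R) hmn x
  have h2 := congrArg (quotientPowMap f m) h
  simpa [quotientPowMap] using h2

/-- The homomorphism `R̂ → Ŝ` induced by a local homomorphism `R → S`. -/
def completedMap (f : R →+* S) [IsLocalHom f] : CompletedRing R →+* CompletedRing S :=
  AdicCompletion.liftRingHom (IsLocalRing.maximalIdeal S)
    (fun n => (quotientPowMap f n).comp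
      (AdicCompletion.evalₐ (IsLocalRing.maximalIdeal R) n).toRingHom)
    (factorPow_quotientPowMap f)

lemma evalₐ_completedMap (f : R →+* S) [IsLocalHom f] (n : ℕ) (x : CompletedRing R) :
    AdicCompletion.evalₐ (IsLocalRing.maximalIdeal S) n (completedMap f x) =
      quotientPowMap f n (AdicCompletion.evalₐ (IsLocalRing.maximalIdeal R) n x) :=
  AdicCompletion.evalₐ_liftRingHom (IsLocalRing.maximalIdeal S) _
    (factorPow_quotientPowMap f) n x

lemma completedMap_completedMap (f : R →+* S) [IsLocalHom f] (g : S →+* T) [IsLocalHom g]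
    (h : R →+* T) [IsLocalHom h] (hgf : g.comp f = h) (x : CompletedRing R) :
    completedMap g (completedMap f x) = completedMap h x := by
  refine AdicCompletion.ext_evalₐ fun n => ?_
  simp only [evalₐ_completedMap]
  obtain ⟨r, hr⟩ := Ideal.Quotient.mk_surjective
    (AdicCompletion.evalₐ (IsLocalRing.maximalIdeal R) n x)
  subst hgf
  rw [← hr]
  simp [quotientPowMap]

lemma completedMap_id (f : R →+* R) [IsLocalHom f] (hf : f = RingHom.id R)
    (x : CompletedRing R) : completedMap f x = x := by
  refine AdicCompletion.ext_evalₐ fun n => ?_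
  simp only [evalₐ_completedMap]
  obtain ⟨r, hr⟩ := Ideal.Quotient.mk_surjective
    (AdicCompletion.evalₐ (IsLocalRing.maximalIdeal R) n x)
  subst hf
  rw [← hr]
  simp [quotientPowMap]

/-- The isomorphism `R̂ ≃ Ŝ` induced by an isomorphism `R ≃ S`. -/
def completedEquiv (e : R ≃+* S) : CompletedRing R ≃+* CompletedRing S :=
  RingEquiv.ofRingHom (completedMap (e : R →+* S)) (completedMap (e.symm : S →+* R))
    (RingHom.ext fun x => by
      have := completedMap_completedMap (e.symm : S →+* R) (e : R →+* S) (RingHom.id S)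
        (by ext; simp) x
      simpa [completedMap_id (RingHom.id S) rfl] using this)
    (RingHom.ext fun x => by
      have := completedMap_completedMap (e : R →+* S) (e.symm : S →+* R) (RingHom.id R)
        (by ext; simp) x
      simpa [completedMap_id (RingHom.id R) rfl] using this)

end Functoriality

variable (R : Type u) [CommRing R] [IsDomain R] [IsDiscreteValuationRing R]

lemma mul_notMem_maximalIdeal_pow {a b : ℕ} {r s : R}
    (hr : r ∉ IsLocalRing.maximalIdeal R ^ a) (hs : s ∉ IsLocalRing.maximalIdeal R ^ b) :
    r * s ∉ IsLocalRing.maximalIdeal R ^ (a + b) := by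
  obtain ⟨ϖ, hϖ⟩ := IsDiscreteValuationRing.exists_irreducible R
  have hm := (IsDiscreteValuationRing.irreducible_iff_uniformizer ϖ).mp hϖ
  rw [hm, Ideal.span_singleton_pow, Ideal.mem_span_singleton] at hr hs ⊢
  have hr0 : r ≠ 0 := by rintro rfl; simp at hr
  have hs0 : s ≠ 0 := by rintro rfl; simp at hs
  obtain ⟨i, u, rfl⟩ := IsDiscreteValuationRing.eq_unit_mul_pow_irreducible hr0 hϖ
  obtain ⟨j, v, rfl⟩ := IsDiscreteValuationRing.eq_unit_mul_pow_irreducible hs0 hϖ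
  simp only [Units.dvd_mul_left, pow_dvd_pow_iff hϖ.ne_zero hϖ.not_isUnit] at hr hs
  have : (u * ϖ ^ i * (v * ϖ ^ j) : R) = ((u * v : Rˣ) : R) * ϖ ^ (i + j) := by
    push_cast; ring
  rw [this, Units.dvd_mul_left, pow_dvd_pow_iff hϖ.ne_zero hϖ.not_isUnit]
  omega

instance completedRing_isDomain : IsDomain (CompletedRing R) := by
  have hex : ∀ x : CompletedRing R, x ≠ 0 →
      ∃ n, AdicCompletion.evalₐ (IsLocalRing.maximalIdeal R) n x ≠ 0 := by
    intro x hx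
    by_contra! h
    exact hx (AdicCompletion.ext_evalₐ fun n => by rw [h n, map_zero])
  have hlift : ∀ (x : CompletedRing R) (a N : ℕ) (r : R), a ≤ N →
      AdicCompletion.evalₐ (IsLocalRing.maximalIdeal R) N x = Ideal.Quotient.mk _ r →
      AdicCompletion.evalₐ (IsLocalRing.maximalIdeal R) a x = Ideal.Quotient.mk _ r := by
    intro x a N r haN h
    obtain ⟨x, rfl⟩ := AdicCompletion.mk_surjective _ _ x
    rw [AdicCompletion.evalₐ_mk] at h ⊢
    rw [← AdicCompletion.Ideal.mk_eq_mk (IsLocalRing.maximalIdeal R) haN x]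
    rw [Ideal.Quotient.eq] at h ⊢
    exact Ideal.pow_le_pow_right haN h
  have : Nontrivial (CompletedRing R) := by
    refine ⟨0, 1, fun h => ?_⟩
    have := congrArg (completedResidue R) h
    simp at this
  have : NoZeroDivisors (CompletedRing R) := by
    refine ⟨fun {x y} hxy => ?_⟩
    by_contra! hne
    obtain ⟨a, ha⟩ := hex x hne.1
    obtain ⟨b, hb⟩ := hex y hne.2
    obtain ⟨r, hr⟩ := Ideal.Quotient.mk_surjective
      (AdicCompletion.evalₐ (IsLocalRing.maximalIdeal R) (a + b) x)
    obtain ⟨s, hs⟩ := Ideal.Quotient.mk_surjective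
      (AdicCompletion.evalₐ (IsLocalRing.maximalIdeal R) (a + b) y)
    rw [hlift x a (a + b) r (by omega) hr.symm, Ne, Ideal.Quotient.eq_zero_iff_mem] at ha
    rw [hlift y b (a + b) s (by omega) hs.symm, Ne, Ideal.Quotient.eq_zero_iff_mem] at hb
    refine mul_notMem_maximalIdeal_pow R ha hb ?_
    rw [← Ideal.Quotient.eq_zero_iff_mem, map_mul, hr, hs, ← map_mul, hxy, map_zero]
  exact NoZeroDivisors.to_isDomain _

/-- The fraction field `QF(R̂)` of the completion of a discrete valuation ring `R`. -/
abbrev CompletedField : Type u := FractionRing (CompletedRing R)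

end Completion

/-! ### Regular curves and Galois covers -/

/-- The closed points of a scheme. -/
abbrev ClosedPoint (X : Scheme.{u}) : Type u := {x : X // IsClosed ({x} : Set X)}

/-- A regular (irreducible) curve: an integral, separated, quasi-compact scheme whose local rings
at closed points are regular of dimension one, that is, discrete valuation rings.  A regular
`k`-curve is a regular curve together with a morphism to `Spec k` locally of finite type. -/
class IsRegularCurve (X : Scheme.{u}) : Prop extends IsIntegral X, X.IsSeparated where
  compactSpace : CompactSpace X
  isDiscreteValuationRing (x : ClosedPoint X) : IsDiscreteValuationRing (X.presheaf.stalk x.1)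

instance (X : Scheme.{u}) [IsRegularCurve X] (x : ClosedPoint X) :
    IsDiscreteValuationRing (X.presheaf.stalk x.1) :=
  IsRegularCurve.isDiscreteValuationRing x

section Maps

variable {X Y : Scheme.{u}} (f : X ⟶ Y)

/-- The homomorphism of local rings `𝒪_{Y,y} → 𝒪_{X,x}` for `f x = y`. -/
def localMap {x : X} {y : Y} (h : f x = y) : Y.presheaf.stalk y →+* X.presheaf.stalk x :=
  ((Y.presheaf.stalkCongr (.of_eq h.symm)).hom ≫ f.stalkMap x).hom

instance {x : X} {y : Y} (h : f x = y) : IsLocalHom (localMap f h) := by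
  unfold localMap
  infer_instance

/-- The homomorphism of residue fields `k(y) → k(x)` for `f x = y`. -/
def residueMap {x : X} {y : Y} (h : f x = y) :
    IsLocalRing.ResidueField (Y.presheaf.stalk y) →+*
      IsLocalRing.ResidueField (X.presheaf.stalk x) :=
  IsLocalRing.ResidueField.map (localMap f h)

/-- `Gal(k(x) / k(y))`, the group of automorphisms of `k(x)` over `k(y)`, for `f x = y`. -/
abbrev ResidueGal {x : X} {y : Y} (h : f x = y) : Type u :=
  letI := (residueMap f h).toAlgebra
  IsLocalRing.ResidueField (X.presheaf.stalk x)
    ≃ₐ[IsLocalRing.ResidueField (Y.presheaf.stalk y)]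
      IsLocalRing.ResidueField (X.presheaf.stalk x)

variable [IsIntegral X] [IsIntegral Y]

lemma apply_genericPoint_of_isDominant [IsDominant f] : f (genericPoint X) = genericPoint Y := by
  have h := (genericPoint_spec X).image f.continuous
  rw [Set.image_univ, f.denseRange.closure_range] at h
  exact h.eq (genericPoint_spec Y)

/-- The homomorphism of function fields `k(Y) → k(X)` induced by a dominant morphism. -/
def functionFieldMap [IsDominant f] : Y.functionField →+* X.functionField :=
  localMap f (apply_genericPoint_of_isDominant f)

/-- The function field `k(X)`, regarded as an extension of `k(Y)` through `f : X ⟶ Y`. -/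
def CoverField (_f : X ⟶ Y) : Type u := X.functionField

instance : Field (CoverField f) := inferInstanceAs (Field X.functionField)

instance [IsDominant f] : Algebra Y.functionField (CoverField f) :=
  (functionFieldMap f).toAlgebra

/-- A (finite, possibly ramified) Galois cover of integral schemes: a finite dominant morphism
such that the extension of function fields is Galois. -/
class IsGaloisCover : Prop extends IsFinite f, IsDominant f where
  isGalois : IsGalois Y.functionField (CoverField f)

/-- The Galois group `Gal(k(X) / k(Y))` of a cover. -/
abbrev CoverGroup [IsDominant f] : Type u := CoverField f ≃ₐ[Y.functionField] CoverField f

end Maps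

/-! ### Decomposition and inertia groups -/

section Decomposition

variable {X Y : Scheme.{u}} (f : X ⟶ Y) [IsRegularCurve X] (x : ClosedPoint X)

instance : Algebra (X.presheaf.stalk x.1) (CoverField f) :=
  inferInstanceAs (Algebra (X.presheaf.stalk x.1) X.functionField)

instance : IsFractionRing (X.presheaf.stalk x.1) (CoverField f) :=
  inferInstanceAs (IsFractionRing (X.presheaf.stalk x.1) X.functionField)

/-- The local ring `𝒪_{X,x}` as a valuation subring of `k(X)`. -/
def localValuationSubring : ValuationSubring (CoverField f) :=
  (ValuationRing.valuation (X.presheaf.stalk x.1) (CoverField f)).valuationSubring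

lemma mem_localValuationSubring (a : CoverField f) :
    a ∈ localValuationSubring f x ↔
      ∃ b : X.presheaf.stalk x.1, algebraMap _ (CoverField f) b = a :=
  ValuationRing.mem_integer_iff _ _ a

/-- The identification of `𝒪_{X,x}` with the valuation subring it defines. -/
def stalkEquiv : X.presheaf.stalk x.1 ≃+* localValuationSubring f x :=
  ValuationRing.equivInteger (X.presheaf.stalk x.1) (CoverField f)

lemma coe_stalkEquiv (a : X.presheaf.stalk x.1) :
    (stalkEquiv f x a : CoverField f) = algebraMap _ (CoverField f) a := rfl

variable [IsIntegral Y] [IsDominant f]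

/-- The decomposition group at `x`: the elements of `Gal(k(X) / k(Y))` that map `𝒪_{X,x}` onto
itself. -/
abbrev decompositionGroup : Subgroup (CoverGroup f) :=
  (localValuationSubring f x).decompositionSubgroup Y.functionField

/-- The inertia group at `x`: the elements of the decomposition group that act trivially on the
residue field at `x`. -/
abbrev inertiaGroup : Subgroup (decompositionGroup f x) :=
  (localValuationSubring f x).inertiaSubgroup Y.functionField

variable {f x}

/-- The action of an element of the decomposition group on `𝒪_{X,x}`. -/
def stalkAut (σ : decompositionGroup f x) : X.presheaf.stalk x.1 ≃+* X.presheaf.stalk x.1 :=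
  ((stalkEquiv f x).trans (MulSemiringAction.toRingEquiv _ (localValuationSubring f x) σ)).trans
    (stalkEquiv f x).symm

lemma algebraMap_stalkAut (σ : decompositionGroup f x) (a : X.presheaf.stalk x.1) :
    algebraMap _ (CoverField f) (stalkAut σ a) =
      (σ : CoverGroup f) (algebraMap _ (CoverField f) a) := by
  rw [← coe_stalkEquiv, ← coe_stalkEquiv]
  simp [stalkAut]
  rfl

/-- The action of an element of the decomposition group on the residue field `k(x)`. -/
def residueAut (σ : decompositionGroup f x) :
    IsLocalRing.ResidueField (X.presheaf.stalk x.1) ≃+*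
      IsLocalRing.ResidueField (X.presheaf.stalk x.1) :=
  IsLocalRing.ResidueField.mapEquiv (stalkAut σ)

/-- The action of an element of the decomposition group on `QF(𝒪̂_{X,x})`. -/
def completedAut (σ : decompositionGroup f x) :
    CompletedField (X.presheaf.stalk x.1) ≃+* CompletedField (X.presheaf.stalk x.1) :=
  IsFractionRing.ringEquivOfRingEquiv (completedEquiv (stalkAut σ))

/-- The fixed field `QF(𝒪̂_{X,x})^N` of a subgroup `N` of the decomposition group. -/
def completedFixedField (N : Subgroup (decompositionGroup f x)) :
    Subfield (CompletedField (X.presheaf.stalk x.1)) :=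
  ⨅ σ : N, RingHom.eqLocusField
    (completedAut (σ : decompositionGroup f x)).toRingHom (RingHom.id _)

lemma mem_completedFixedField (N : Subgroup (decompositionGroup f x))
    (a : CompletedField (X.presheaf.stalk x.1)) :
    a ∈ completedFixedField N ↔ ∀ σ ∈ N, completedAut σ a = a := by
  simp [completedFixedField, Subfield.mem_iInf, RingHom.eqLocusField]

end Decomposition

/-! ### Coefficient fields -/

/-- Compatible coefficient fields `k(y) ⊆ 𝒪̂_{Y,y}` and `k(x) ⊆ 𝒪̂_{X,x}`, for `f x = y`: sections
of the two reduction maps that commute with the maps `k(y) → k(x)` and `𝒪̂_{Y,y} → 𝒪̂_{X,x}`. -/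
structure CompatibleCoefficientFields {X Y : Scheme.{u}} (f : X ⟶ Y) {x : X} {y : Y}
    (h : f x = y) where
  base : IsLocalRing.ResidueField (Y.presheaf.stalk y) →+* CompletedRing (Y.presheaf.stalk y)
  top : IsLocalRing.ResidueField (X.presheaf.stalk x) →+* CompletedRing (X.presheaf.stalk x)
  base_section : (completedResidue (Y.presheaf.stalk y)).comp base = RingHom.id _
  top_section : (completedResidue (X.presheaf.stalk x)).comp top = RingHom.id _
  comm : top.comp (residueMap f h) = (completedMap (localMap f h)).comp base

/-! ### Normalized fibre products -/

section Normalization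

variable {P W : Scheme.{u}} [QuasiSeparatedSpace P]

/-- `ν : W ⟶ P` is (up to isomorphism) an irreducible component of the normalization of `P`.
The normalization of `P` is the disjoint union of the normalizations of the irreducible components
of `P` (with their reduced structure), and the normalization of the component with generic point
`ξ` is the normalization of `P` in `Spec k(ξ)`. -/
def IsComponentOfNormalization (ν : W ⟶ P) : Prop :=
  ∃ ξ : P, closure {ξ} ∈ irreducibleComponents P ∧
    ∃ e : W ≅ (P.fromSpecResidueField ξ).normalization,
      ν = e.hom ≫ (P.fromSpecResidueField ξ).fromNormalization

end Normalization

instance {X Y Z : Scheme.{u}} (f : X ⟶ Y) (g : Z ⟶ Y) [QuasiSeparatedSpace Z] [IsAffineHom f] :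
    QuasiSeparatedSpace ↥(pullback f g) :=
  quasiSeparatedSpace_of_quasiSeparated (pullback.snd f g)

end CoverInertia

end

open CoverInertia

/-!
Write `K`, `L`, `M`, `F` for the function fields of `Y`, `X`, `Z`, `W`. The argument embeds `F`
into the complete field `Ω = QF(𝒪̂_{X,x})` and reads off the decomposition group of `W → Z` from
the action of that of `X → Y` on `Ω`.

*Geometry.* The field `F` is generated by `L` and `M`: if `F₀` is the subfield they generate, then
`Spec F₀` maps to the fibre product, so that `F₀` contains the residue field at the generic point
of the component (`subfield_functionField_eq_top`). Hence `F / M` is finite Galois. Over an affine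
open of `Z` the sections of `W` form the integral closure in `F`, which is a finite Dedekind
extension; therefore `W` is a regular curve and `W → Z` a Galois cover (`isGaloisCover_component`).

*The embedding.* As `M / K` is normal and embeds into `Ω`, so does `F` over `L`; as the valuation
rings of `F` above `𝒪_{X,x}` are conjugate over `L`, the embedding `e : F → Ω` can be chosen such
that `𝒪_{W,w}` is the preimage of `𝒪̂_{X,x}` (`exists_algHom_mem_range_iff`). Since `𝒪_{X,x}` is
dense in its completion it is dense in `𝒪_{W,w}`. This gives `k(w) = k(x)`, and shows that an
element `σ` of the decomposition group at `w` acts on `e(F)` as the continuous extension of its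
restriction `n` to `L` (`map_algHom_eq_of_dense`). In particular this extension is trivial on the
image of `M`, hence by continuity on that of `QF(𝒪̂_{Z,z})`; the embedding of the latter is
continuous since a homomorphism out of the fraction field of a Henselian discrete valuation ring
maps integers to integers (`mem_range_of_henselian`). Conversely, if the extension of `n` fixes the
image of `QF(𝒪̂_{Z,z})`, then it preserves `e(F)` and thus comes from an element `σ`
(`residueMap_surjective_and_exists_lift_iff`).

*Inertia.* Elements of `N` fix `QF(𝒪̂_{X,x})^N`, so they lift. Conversely, the restriction `n` of
an element of the inertia group at `w` lies in the inertia group at `x`. It then acts trivially on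
the coefficient field `k(x)`, because a lift of an algebraic extension of residue fields is unique
(`ringHom_eq_of_sub_mem_maximalIdeal`). So `n` fixes the compositum of `QF(𝒪̂_{Z,z})` and `k(x)`,
which is the fixed field of `N`, and `n ∈ N` by Artin's theorem
(`mem_of_forall_completedFixedField`).

*Residue fields.* The decomposition group at `w` surjects onto `Aut(k(w) / k(z))`
(`exists_residueAut_eq`), which is `Gal(k(x) / k(τ))` because `k(w) = k(x)` and `k(z) = k(τ)`.
-/

noncomputable section

namespace CoverInertia

/-! ### Composita of field extensions -/

section Compositum

lemma adjoin_range_eq_top_of_forall_subfield {L M F : Type*} [Field L] [Field M] [Field F]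
    [Algebra L F] [Algebra M F] (h : ∀ F₀ : Subfield F,
      (∀ l, algebraMap L F l ∈ F₀) → (∀ m, algebraMap M F m ∈ F₀) → F₀ = ⊤) :
    IntermediateField.adjoin L (Set.range (algebraMap M F)) = ⊤ := by
  have hF := h (IntermediateField.adjoin L (Set.range (algebraMap M F))).toSubfield
    (IntermediateField.algebraMap_mem _)
    fun m => IntermediateField.subset_adjoin L _ ⟨m, rfl⟩
  exact IntermediateField.toSubfield_injective hF

variable {K L M F Ω : Type*} [Field K] [Field L] [Field M] [Field F] [Field Ω]
  [Algebra K L] [Algebra K M] [Algebra K F] [Algebra L F] [Algebra M F]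
  [IsScalarTower K L F] [IsScalarTower K M F]

lemma exists_isSplittingField_of_adjoin_range_eq_top [FiniteDimensional K M] [IsGalois K M]
    (h : IntermediateField.adjoin L (Set.range (algebraMap M F)) = ⊤) :
    ∃ p : Polynomial L, p.Separable ∧ p.IsSplittingField L F := by
  obtain ⟨p, hp, hs⟩ := IsGalois.is_separable_splitting_field K M
  refine ⟨p.map (algebraMap K L), hp.map, ?_⟩
  rw [isSplittingField_iff_intermediateField] at hs ⊢
  have hsp : (p.map (algebraMap K F)).Splits :=
    Polynomial.Splits.of_algHom hs.1 (IsScalarTower.toAlgHom K M F)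
  refine ⟨by rwa [Polynomial.map_map, ← IsScalarTower.algebraMap_eq], ?_⟩
  have h' : (p.map (algebraMap K L)).rootSet F = p.rootSet F := by
    simp [Set.ext_iff, Polynomial.mem_rootSet']
  rw [h', eq_top_iff, ← h, IntermediateField.adjoin_le_iff]
  -- the roots of `p` generate `M` over `K`, hence the image of `M` over `L`
  have key : (⊤ : IntermediateField K M) ≤
      ((IntermediateField.adjoin L (p.rootSet F)).restrictScalars K).comap
        (IsScalarTower.toAlgHom K M F) := by
    rw [← hs.2, IntermediateField.adjoin_le_iff]
    intro a ha
    refine IntermediateField.subset_adjoin L _ ?_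
    exact Polynomial.rootSet_mapsTo (IsScalarTower.toAlgHom K M F) ha
  rintro _ ⟨m, rfl⟩
  exact key (IntermediateField.mem_top (x := m))

lemma finiteDimensional_of_adjoin_range_eq_top [FiniteDimensional K M] [IsGalois K M]
    (h : IntermediateField.adjoin L (Set.range (algebraMap M F)) = ⊤) :
    FiniteDimensional L F := by
  obtain ⟨p, -, hs⟩ := exists_isSplittingField_of_adjoin_range_eq_top (K := K) h
  exact Polynomial.IsSplittingField.finiteDimensional F p

lemma isGalois_of_adjoin_range_eq_top [FiniteDimensional K M] [IsGalois K M]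
    (h : IntermediateField.adjoin L (Set.range (algebraMap M F)) = ⊤) :
    IsGalois L F := by
  obtain ⟨p, hp, hs⟩ := exists_isSplittingField_of_adjoin_range_eq_top (K := K) h
  exact IsGalois.of_separable_splitting_field hp

variable [Algebra K Ω] [Algebra L Ω] [IsScalarTower K L Ω]

lemma nonempty_algHom_of_adjoin_range_eq_top [Normal K M] (j : M →ₐ[K] Ω)
    (h : IntermediateField.adjoin L (Set.range (algebraMap M F)) = ⊤) :
    Nonempty (F →ₐ[L] Ω) := by
  refine IntermediateField.nonempty_algHom_of_adjoin_splits ?_ h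
  rintro _ ⟨m, rfl⟩
  have hm : IsIntegral K m := Normal.isIntegral inferInstance m
  have hm' : IsIntegral K (algebraMap M F m) := hm.map (IsScalarTower.toAlgHom K M F)
  refine ⟨hm'.tower_top, ?_⟩
  have hsp : ((minpoly K m).map (algebraMap K Ω)).Splits :=
    Polynomial.Splits.of_algHom (Normal.splits inferInstance m) j
  have hdvd : minpoly L (algebraMap M F m) ∣ (minpoly K m).map (algebraMap K L) := by
    rw [← minpoly.algebraMap_eq (algebraMap M F).injective m]
    exact minpoly.dvd_map_of_isScalarTower K L _
  refine Polynomial.Splits.of_dvd ?_ ?_ (Polynomial.map_dvd (algebraMap L Ω) hdvd)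
  · rwa [Polynomial.map_map, ← IsScalarTower.algebraMap_eq]
  · exact Polynomial.map_ne_zero (Polynomial.map_ne_zero (minpoly.ne_zero hm))

/-- Two embeddings of a normal extension have the same image. -/
lemma mem_range_of_normal [Normal K M] (f g : M →ₐ[K] Ω) (m : M) : g m ∈ f.range := by
  have hm : IsIntegral K m := Normal.isIntegral inferInstance m
  have hs := Normal.splits (F := K) inferInstance m
  have := hs.image_rootSet f
  have hg : g m ∈ (minpoly K m).rootSet Ω := by
    rw [Polynomial.mem_rootSet]
    exact ⟨minpoly.ne_zero hm, by rw [Polynomial.aeval_algHom_apply]; simp⟩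
  rw [← this] at hg
  obtain ⟨a, -, ha⟩ := hg
  exact ⟨a, ha⟩

end Compositum

/-! ### Completions of discrete valuation rings -/

section Completion

open IsLocalRing

variable (R : Type u) [CommRing R] [IsDomain R] [IsDiscreteValuationRing R]

lemma completedRing_map_maximalIdeal :
    (maximalIdeal R).map (algebraMap R (CompletedRing R)) = maximalIdeal (CompletedRing R) :=
  AdicCompletion.maximalIdeal_eq_map.symm

lemma algebraMap_completedRing_injective :
    Function.Injective (algebraMap R (CompletedRing R)) := by
  rw [injective_iff_map_eq_zero]
  intro r hr
  by_contra hr0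
  obtain ⟨ϖ, hϖ⟩ := IsDiscreteValuationRing.exists_irreducible R
  obtain ⟨i, v, rfl⟩ := IsDiscreteValuationRing.eq_unit_mul_pow_irreducible hr0 hϖ
  have h := congrArg (AdicCompletion.evalₐ (maximalIdeal R) (i + 1)) hr
  rw [map_zero, AdicCompletion.algebraMap_apply, Algebra.algebraMap_self, RingHom.id_apply,
    AdicCompletion.evalₐ_of, Ideal.Quotient.eq_zero_iff_mem,
    (IsDiscreteValuationRing.irreducible_iff_uniformizer ϖ).mp hϖ, Ideal.span_singleton_pow,
    Ideal.mem_span_singleton, Units.dvd_mul_left,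
    pow_dvd_pow_iff hϖ.ne_zero hϖ.not_isUnit] at h
  omega

variable {R} in
lemma maximalIdeal_completedRing_eq_span {ϖ : R} (hϖ : Irreducible ϖ) :
    maximalIdeal (CompletedRing R) = Ideal.span {algebraMap R (CompletedRing R) ϖ} := by
  have h : Ideal.map (algebraMap R (CompletedRing R)) (maximalIdeal R) =
      Ideal.map (algebraMap R (CompletedRing R)) (Ideal.span {ϖ}) :=
    congrArg _ ((IsDiscreteValuationRing.irreducible_iff_uniformizer ϖ).mp hϖ)
  rw [← completedRing_map_maximalIdeal, h, Ideal.map_span, Set.image_singleton]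

instance completedRing_isDiscreteValuationRing : IsDiscreteValuationRing (CompletedRing R) := by
  obtain ⟨ϖ, hϖ⟩ := IsDiscreteValuationRing.exists_irreducible R
  have hm := maximalIdeal_completedRing_eq_span hϖ
  have hne : algebraMap R (CompletedRing R) ϖ ≠ 0 := by
    rw [Ne, map_eq_zero_iff _ (algebraMap_completedRing_injective R)]
    exact hϖ.ne_zero
  refine IsDiscreteValuationRing.ofHasUnitMulPowIrreducibleFactorization
    ⟨_, IsDiscreteValuationRing.irreducible_of_span_eq_maximalIdeal _ hne hm, fun {x} hx => ?_⟩
  have hex : ∃ n, x ∉ maximalIdeal (CompletedRing R) ^ n := by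
    by_contra! h
    exact hx (IsHausdorff.haus' (I := maximalIdeal (CompletedRing R)) x fun n => by
      simpa [SModEq.zero] using h n)
  classical
  obtain ⟨k, hk⟩ : ∃ k, Nat.find hex = k + 1 := by
    refine Nat.exists_eq_succ_of_ne_zero (n := Nat.find hex) fun h => ?_
    have := Nat.find_spec hex
    simp [h] at this
  have h1 := Nat.find_spec hex
  have h2 := Nat.find_min hex (m := k) (by omega)
  rw [not_not, hm, Ideal.span_singleton_pow, Ideal.mem_span_singleton] at h2
  rw [hk, hm, Ideal.span_singleton_pow, Ideal.mem_span_singleton] at h1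
  obtain ⟨y, rfl⟩ := h2
  have hy : IsUnit y := by
    by_contra hy
    have hy' : y ∈ maximalIdeal (CompletedRing R) := hy
    rw [hm, Ideal.mem_span_singleton] at hy'
    exact h1 (by rw [pow_succ]; exact mul_dvd_mul_left _ hy')
  exact ⟨k, associated_mul_unit_right _ _ hy⟩

lemma completedResidue_eq_zero_iff (x : CompletedRing R) :
    completedResidue R x = 0 ↔ x ∈ maximalIdeal (CompletedRing R) := by
  rw [← completedRing_map_maximalIdeal,
    ← AdicCompletion.ker_evalOneₐ_eq_map _ (IsNoetherian.noetherian _), RingHom.mem_ker]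
  rfl

lemma completedResidue_algebraMap (r : R) :
    completedResidue R (algebraMap R (CompletedRing R) r) = residue R r := rfl

variable {R}

/-- `R` is dense in its completion. -/
lemma exists_sub_algebraMap_mem_maximalIdeal_pow (x : CompletedRing R) (n : ℕ) :
    ∃ r : R, x - algebraMap R (CompletedRing R) r ∈ maximalIdeal (CompletedRing R) ^ n := by
  obtain ⟨r, hr⟩ := Ideal.Quotient.mk_surjective (AdicCompletion.evalₐ (maximalIdeal R) n x)
  refine ⟨r, ?_⟩
  have h := AdicCompletion.pow_smul_top_eq_ker_eval (I := maximalIdeal R) (M := R) (n := n)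
    (IsNoetherian.noetherian _)
  rw [← completedRing_map_maximalIdeal, ← Ideal.map_pow, ← Submodule.restrictScalars_mem R,
    ← Ideal.smul_top_eq_map, h, LinearMap.mem_ker]
  obtain ⟨y, rfl⟩ := AdicCompletion.mk_surjective _ _ x
  rw [AdicCompletion.evalₐ_mk] at hr
  rw [map_sub, sub_eq_zero]
  change Ideal.Quotient.mk _ (y.1 n) = Ideal.Quotient.mk _ r
  rw [Ideal.Quotient.eq] at hr
  rw [eq_comm, Ideal.Quotient.eq]
  simpa using hr

variable {S : Type u} [CommRing S] [IsDomain S] [IsDiscreteValuationRing S]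

lemma completedMap_algebraMap (f : R →+* S) [IsLocalHom f] (r : R) :
    completedMap f (algebraMap R (CompletedRing R) r) = algebraMap S (CompletedRing S) (f r) := by
  refine AdicCompletion.ext_evalₐ fun n => ?_
  rw [evalₐ_completedMap]
  rfl

lemma completedMap_mem_maximalIdeal_pow (f : R →+* S) [IsLocalHom f] {x : CompletedRing R} {n : ℕ}
    (hx : x ∈ maximalIdeal (CompletedRing R) ^ n) :
    completedMap f x ∈ maximalIdeal (CompletedRing S) ^ n := by
  obtain ⟨ϖ, hϖ⟩ := IsDiscreteValuationRing.exists_irreducible R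
  rw [maximalIdeal_completedRing_eq_span hϖ, Ideal.span_singleton_pow,
    Ideal.mem_span_singleton] at hx
  obtain ⟨y, rfl⟩ := hx
  rw [map_mul, map_pow, completedMap_algebraMap]
  refine Ideal.mul_mem_right _ _ (Ideal.pow_mem_pow ?_ n)
  rw [← completedRing_map_maximalIdeal]
  refine Ideal.mem_map_of_mem _ ?_
  exact fun h => hϖ.not_isUnit (isUnit_of_map_unit f ϖ h)

lemma completedResidue_completedMap (f : R →+* S) [IsLocalHom f] (x : CompletedRing R) :
    completedResidue S (completedMap f x) = ResidueField.map f (completedResidue R x) := by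
  obtain ⟨r, hr⟩ := exists_sub_algebraMap_mem_maximalIdeal_pow x 1
  have h := completedMap_mem_maximalIdeal_pow f hr
  rw [pow_one, ← completedResidue_eq_zero_iff, map_sub, sub_eq_zero] at hr
  rw [pow_one, ← completedResidue_eq_zero_iff, map_sub, map_sub, sub_eq_zero] at h
  rw [h, hr, completedMap_algebraMap, completedResidue_algebraMap, completedResidue_algebraMap,
    ResidueField.map_residue]

end Completion

/-! ### Ring homomorphisms into complete and Henselian rings -/

section Lifting

open IsLocalRing Polynomial

/-- A homomorphism from a field to a local domain is determined by its reduction and its restriction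
to a subfield over which the field is algebraic.  The separable elements are dealt with by the
uniqueness in Hensel's lemma, the purely inseparable ones by the injectivity of Frobenius. -/
lemma ringHom_eq_of_sub_mem_maximalIdeal {κ₀ κ A : Type*} [Field κ₀] [Field κ] [Algebra κ₀ κ]
    [Algebra.IsAlgebraic κ₀ κ] [CommRing A] [IsDomain A] [IsLocalRing A] (t u : κ →+* A)
    (h₀ : ∀ a : κ₀, u (algebraMap κ₀ κ a) = t (algebraMap κ₀ κ a))
    (hm : ∀ a : κ, u a - t a ∈ maximalIdeal A) : u = t := by
  -- the equalizer `E` of `t` and `u` is separably closed in `κ`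
  let E : IntermediateField κ₀ κ :=
    { (u.eqLocus t) with
      algebraMap_mem' := h₀
      inv_mem' := fun a ha => by
        rcases eq_or_ne a 0 with rfl | ha0
        · simp
        change u a = t a at ha
        change u a⁻¹ = t a⁻¹
        have hu : u a * u a⁻¹ = 1 := by rw [← map_mul, mul_inv_cancel₀ ha0, map_one]
        have ht : t a * t a⁻¹ = 1 := by rw [← map_mul, mul_inv_cancel₀ ha0, map_one]
        rw [← ha] at ht
        exact mul_left_cancel₀ (left_ne_zero_of_mul_eq_one hu) (hu.trans ht.symm) }
  have hE : ∀ a : κ, a ∈ E ↔ u a = t a := fun _ => Iff.rfl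
  have hsep : ∀ a : κ, IsSeparable E a → a ∈ E := by
    intro a ha
    rw [hE]
    let f := (minpoly E a).map ((t : κ →+* A).comp (algebraMap E κ))
    have hf : (minpoly E a).map (u.comp (algebraMap E κ)) = f := by
      refine congrArg (fun φ => (minpoly E a).map φ) (RingHom.ext fun e => e.2)
    have hta : f.eval (t a) = 0 := by
      rw [Polynomial.eval_map, ← hom_eval₂, ← aeval_def, minpoly.aeval, map_zero]
    have hua : f.eval (u a) = 0 := by
      rw [← hf, Polynomial.eval_map, ← hom_eval₂, ← aeval_def, minpoly.aeval, map_zero]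
    have hder : IsUnit (f.derivative.eval (u a)) := by
      rw [← hf, derivative_map, Polynomial.eval_map, ← hom_eval₂, ← aeval_def]
      exact (IsUnit.mk0 _ (ha.aeval_derivative_ne_zero (minpoly.aeval E a))).map u
    refine IsLocalRing.eq_of_eval_eq_zero_of_not_isUnit_sub hua hta (hm a) hder
  have : IsPurelyInseparable E κ := by
    rw [isPurelyInseparable_iff]
    exact fun a => ⟨(Algebra.IsIntegral.isIntegral (R := κ₀) a).tower_top,
      fun ha => ⟨⟨a, hsep a ha⟩, rfl⟩⟩
  refine RingHom.ext fun a => ?_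
  obtain ⟨q, hq⟩ := ExpChar.exists κ
  obtain ⟨n, e, he⟩ := IsPurelyInseparable.pow_mem E q a
  have : ExpChar A q := expChar_of_injective_ringHom t.injective q
  have h1 : u (a ^ q ^ n) = t (a ^ q ^ n) := by rw [← he]; exact e.2
  rw [map_pow, map_pow] at h1
  exact iterateFrobenius_inj A q n h1

end Lifting

/-! ### Homomorphisms between discretely valued fields -/

section Valuation

open IsLocalRing Polynomial

section DVR

variable {B E : Type*} [CommRing B] [IsDomain B] [IsDiscreteValuationRing B] [Field E] [Algebra B E]
  [IsFractionRing B E]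

/-- An element of the fraction field outside a valuation ring has a noninvertible inverse. -/
lemma exists_mem_maximalIdeal_of_notMem_range {c : E} (hc : c ∉ (algebraMap B E).range) :
    ∃ b ∈ maximalIdeal B, algebraMap B E b * c = 1 := by
  have hc0 : c ≠ 0 := by rintro rfl; exact hc (zero_mem _)
  rcases ValuationRing.isInteger_or_isInteger B c with h | ⟨b, hb⟩
  · exact absurd h hc
  · refine ⟨b, fun hu => hc ?_, by rw [hb, inv_mul_cancel₀ hc0]⟩
    obtain ⟨v, rfl⟩ := hu
    refine ⟨((v⁻¹ : Bˣ) : B), ?_⟩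
    rw [← inv_inv c, ← hb, ← map_units_inv]

lemma eq_zero_of_forall_mem_maximalIdeal_pow {b : B} {s : ℕ → ℕ} (hs : ∀ n, n ≤ s n)
    (h : ∀ n, b ∈ maximalIdeal B ^ s n) : b = 0 := by
  have h' : b ∈ ⨅ i : ℕ, maximalIdeal B ^ i :=
    Ideal.mem_iInf.mpr fun n => Ideal.pow_le_pow_right (hs n) (h n)
  rwa [Ideal.iInf_pow_eq_bot_of_isLocalRing _ (Ideal.IsPrime.ne_top'), Ideal.mem_bot] at h'

/-- An element of a discretely valued field with roots of arbitrarily large order has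
nonnegative valuation. -/
lemma mem_range_of_forall_exists_pow_eq {c : E} {s : ℕ → ℕ} (hs : ∀ n, n ≤ s n)
    (h : ∀ n, ∃ d : E, d ^ s n = c) : c ∈ (algebraMap B E).range := by
  by_contra hc
  obtain ⟨b, hb, hbc⟩ := exists_mem_maximalIdeal_of_notMem_range hc
  have hb0 : b = 0 := by
    refine eq_zero_of_forall_mem_maximalIdeal_pow hs fun n => ?_
    obtain ⟨d, hd⟩ := h n
    have hdn : d ∉ (algebraMap B E).range := fun hd' => hc (hd ▸ pow_mem hd' _)
    obtain ⟨b', hb', hbd⟩ := exists_mem_maximalIdeal_of_notMem_range hdn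
    have hc0 : c ≠ 0 := right_ne_zero_of_mul_eq_one hbc
    have : b = b' ^ s n := by
      apply IsFractionRing.injective B E
      apply mul_right_cancel₀ hc0
      rw [hbc, map_pow, ← hd, ← mul_pow, hbd, one_pow]
    rw [this]
    exact Ideal.pow_mem_pow hb' _
  rw [hb0, map_zero, zero_mul] at hbc
  exact zero_ne_one hbc

/-- Discrete valuation rings are completely integrally closed. -/
lemma mem_range_of_forall_pow_mul_mem_range {a c : E} (hc : c ≠ 0)
    (h : ∀ n : ℕ, a ^ n * c ∈ (algebraMap B E).range) : a ∈ (algebraMap B E).range := by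
  by_contra ha
  obtain ⟨b, hb, hba⟩ := exists_mem_maximalIdeal_of_notMem_range ha
  obtain ⟨c', hc'⟩ := h 0
  rw [pow_zero, one_mul] at hc'
  have : c' = 0 := by
    refine eq_zero_of_forall_mem_maximalIdeal_pow (s := id) (fun _ => le_rfl) fun n => ?_
    obtain ⟨r, hr⟩ := h n
    have : c' = b ^ n * r := by
      apply IsFractionRing.injective B E
      rw [map_mul, hr, map_pow, ← mul_assoc, ← mul_pow, hba, one_pow, one_mul, hc']
    rw [this]
    exact Ideal.mul_mem_right _ _ (Ideal.pow_mem_pow hb _)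
  rw [← hc', this, map_zero] at hc
  exact hc rfl

end DVR

lemma HenselianLocalRing.exists_pow_eq {A : Type*} [CommRing A] [HenselianLocalRing A] {n : ℕ}
    (hn : IsUnit (n : A)) (h0 : n ≠ 0) {x : A} (hx : x ∈ maximalIdeal A) :
    ∃ y : A, y ^ n = 1 + x := by
  obtain ⟨a, ha, -⟩ := HenselianLocalRing.is_henselian (X ^ n - C (1 + x))
    (monic_X_pow_sub_C _ h0) 1 (by simpa using hx) (by simpa [derivative_X_pow] using hn)
  exact ⟨a, by simpa [sub_eq_zero] using ha⟩

/-- A homomorphism from the fraction field of a Henselian discrete valuation ring to that of another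
discrete valuation ring maps integers to integers.  Indeed `1 + 𝔪` is `n`-divisible for `n` prime to
the residue characteristic, so that its image has valuation `0`. -/
lemma mem_range_of_henselian {A E₁ B E₂ : Type*} [CommRing A] [IsDomain A]
    [IsDiscreteValuationRing A] [HenselianLocalRing A] [Field E₁] [Algebra A E₁]
    [IsFractionRing A E₁] [CommRing B] [IsDomain B] [IsDiscreteValuationRing B] [Field E₂]
    [Algebra B E₂] [IsFractionRing B E₂] (ι : E₁ →+* E₂) (a : A) :
    ι (algebraMap A E₁ a) ∈ (algebraMap B E₂).range := by
  -- one of `2` and `3` is invertible in `A`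
  obtain ⟨ℓ, hℓ1, hℓ⟩ : ∃ ℓ : ℕ, 1 < ℓ ∧ IsUnit (ℓ : A) := by
    by_contra! h
    have h2 : ((2 : ℕ) : A) ∈ maximalIdeal A := h 2 (by norm_num)
    have h3 : ((3 : ℕ) : A) ∈ maximalIdeal A := h 3 (by norm_num)
    have : (1 : A) ∈ maximalIdeal A := by
      have := Ideal.sub_mem _ h3 h2
      push_cast at this
      norm_num at this
    exact (Ideal.ne_top_iff_one _).mp (maximalIdeal.isMaximal A).ne_top this
  have hm : ∀ x ∈ maximalIdeal A, ι (algebraMap A E₁ x) ∈ (algebraMap B E₂).range := by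
    intro x hx
    have h1 : ι (algebraMap A E₁ (1 + x)) ∈ (algebraMap B E₂).range := by
      refine mem_range_of_forall_exists_pow_eq (s := fun n => ℓ ^ n)
        (fun n => (Nat.lt_pow_self hℓ1).le) fun n => ?_
      obtain ⟨y, hy⟩ := HenselianLocalRing.exists_pow_eq (n := ℓ ^ n)
        (by push_cast; exact hℓ.pow n) (by positivity) hx
      exact ⟨ι (algebraMap A E₁ y), by rw [← map_pow, ← map_pow, hy]⟩
    have := sub_mem h1 (one_mem (algebraMap B E₂).range)
    rwa [map_add, map_add, map_one, map_one, add_sub_cancel_left] at this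
  -- all `a ^ n * ϖ` lie in `𝔪`, so `ι a` is almost integral
  obtain ⟨ϖ, hϖ⟩ := IsDiscreteValuationRing.exists_irreducible A
  refine mem_range_of_forall_pow_mul_mem_range (c := ι (algebraMap A E₁ ϖ)) ?_ fun n => ?_
  · rw [Ne, map_eq_zero, map_eq_zero_iff _ (IsFractionRing.injective A E₁)]
    exact hϖ.ne_zero
  · rw [← map_pow, ← map_mul, ← map_pow, ← map_mul]
    exact hm _ (Ideal.mul_mem_left _ _ hϖ.not_isUnit)

end Valuation

/-! ### Valuation rings of a Galois extension above a discrete valuation ring -/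

section Extension

open IsLocalRing
open scoped Pointwise

lemma mem_valuationSubring_of_isIntegral {R F : Type*} [CommRing R] [Field F] [Algebra R F]
    {V : ValuationSubring F} (hV : ∀ r : R, algebraMap R F r ∈ V) {f : F}
    (hf : IsIntegral R f) : f ∈ V := by
  obtain ⟨p, hp, hpf⟩ := hf
  let φ : R →+* V := (algebraMap R F).codRestrict V hV
  have hφ : (algebraMap V F).comp φ = algebraMap R F := rfl
  have : IsIntegral V f := ⟨p.map φ, hp.map φ, by rwa [Polynomial.eval₂_map, hφ]⟩
  obtain ⟨v, rfl⟩ := IsIntegrallyClosed.algebraMap_eq_of_integral this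
  exact v.2

variable {R L F : Type*} [CommRing R] [IsDomain R] [IsDiscreteValuationRing R] [Field L]
  [Algebra R L] [IsFractionRing R L] [Field F] [Algebra L F] [Algebra R F] [IsScalarTower R L F]
  {V : ValuationSubring F}

variable (R) in
/-- The inclusion into a valuation ring of the integral closure of a subring. -/
def integralClosureInclusion (hV : ∀ r : R, algebraMap R F r ∈ V) :
    integralClosure R F →+* V :=
  ((integralClosure R F).val : integralClosure R F →+* F).codRestrict V
    fun b => mem_valuationSubring_of_isIntegral hV b.2

/-- The prime ideal of the integral closure of `R` at which `V` is centred. -/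
def integralClosureCentre (hV : ∀ r : R, algebraMap R F r ∈ V) :
    Ideal (integralClosure R F) :=
  RingHom.ker ((residue V).comp (integralClosureInclusion R hV))

instance (hV : ∀ r : R, algebraMap R F r ∈ V) : (integralClosureCentre hV).IsPrime :=
  RingHom.ker_isPrime _

omit [IsDomain R] [IsDiscreteValuationRing R] in
lemma mem_integralClosureCentre (hV : ∀ r : R, algebraMap R F r ∈ V) (b : integralClosure R F) :
    b ∈ integralClosureCentre hV ↔ integralClosureInclusion R hV b ∈ maximalIdeal V := by
  rw [integralClosureCentre, RingHom.mem_ker, RingHom.comp_apply, residue_eq_zero_iff]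

lemma under_integralClosureCentre (hV : ∀ r : R, algebraMap R F r ∈ V)
    (hm : ∀ r ∈ maximalIdeal R, algebraMap R F r ∈ V.nonunits) :
    (integralClosureCentre hV).under R = maximalIdeal R := by
  refine (((maximalIdeal.isMaximal R).eq_of_le ?_ ?_)).symm
  · exact Ideal.IsPrime.ne_top inferInstance
  · intro r hr
    rw [Ideal.under, Ideal.mem_comap, mem_integralClosureCentre, ← V.coe_mem_nonunits_iff]
    exact hm r hr

/-- `V` is the localization of the integral closure of `R` at the centre of `V`. -/
lemma mem_valuationSubring_iff [FiniteDimensional L F] [Algebra.IsSeparable L F]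
    (hV : ∀ r : R, algebraMap R F r ∈ V)
    (hm : ∀ r ∈ maximalIdeal R, algebraMap R F r ∈ V.nonunits) (f : F) :
    f ∈ V ↔ ∃ b s : integralClosure R F, s ∉ integralClosureCentre hV ∧ f * s = b := by
  have : IsDedekindDomain (integralClosure R F) := integralClosure.isDedekindDomain R L F
  have : IsFractionRing (integralClosure R F) F :=
    integralClosure.isFractionRing_of_finite_extension L F
  constructor
  · intro hf
    set Q := integralClosureCentre hV
    have hQ : Q ≠ ⊥ := by
      intro h
      have h' := under_integralClosureCentre hV hm
      obtain ⟨ϖ, hϖ⟩ := IsDiscreteValuationRing.exists_irreducible R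
      have hmem : ϖ ∈ Q.under R := h' ▸ hϖ.not_isUnit
      rw [h, Ideal.under, Ideal.mem_comap, Ideal.mem_bot] at hmem
      have h0 : algebraMap L F (algebraMap R L ϖ) = 0 := by
        rw [← IsScalarTower.algebraMap_apply]
        exact congrArg Subtype.val hmem
      rw [map_eq_zero, map_eq_zero_iff _ (IsFractionRing.injective R L)] at h0
      exact hϖ.ne_zero h0
    -- the localization at the centre is a valuation ring, so it contains `f` or `f⁻¹`
    let BQ := Localization.subalgebra.ofField F Q.primeCompl Q.primeCompl_le_nonZeroDivisors
    have : IsLocalization.AtPrime BQ Q :=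
      Localization.subalgebra.isLocalization_ofField F Q.primeCompl _
    have : IsDiscreteValuationRing BQ :=
      IsLocalization.AtPrime.isDiscreteValuationRing_of_dedekind_domain _ hQ BQ
    have key : ∀ g : F, g ∈ BQ ↔
        ∃ b s : integralClosure R F, s ∉ Q ∧ g * s = b := by
      intro g
      constructor
      · rintro ⟨b, s, hs, rfl⟩
        refine ⟨b, s, hs, ?_⟩
        have hs0 : (algebraMap (integralClosure R F) F) s ≠ 0 := by
          rw [Ne, map_eq_zero_iff _ (IsFractionRing.injective _ F)]
          rintro rfl
          exact hs (zero_mem _)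
        exact inv_mul_cancel_right₀ hs0 _
      · rintro ⟨b, s, hs, hbs⟩
        refine ⟨b, s, hs, ?_⟩
        have hs0 : (algebraMap (integralClosure R F) F) s ≠ 0 := by
          rw [Ne, map_eq_zero_iff _ (IsFractionRing.injective _ F)]
          rintro rfl
          exact hs (zero_mem _)
        exact (eq_mul_inv_iff_mul_eq₀ hs0).mpr hbs
    rcases ValuationRing.isInteger_or_isInteger BQ f with ⟨x, hx⟩ | ⟨x, hx⟩
    · exact (key f).mp (hx ▸ x.2)
    · obtain ⟨b, s, hs, hbs⟩ := (key f⁻¹).mp (hx ▸ x.2)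
      rcases eq_or_ne f 0 with rfl | hf0
      · exact ⟨0, s, hs, by simp⟩
      refine ⟨s, b, fun hb => hs ?_, ?_⟩
      · rw [mem_integralClosureCentre] at hb ⊢
        have : integralClosureInclusion R hV s = ⟨f, hf⟩ * integralClosureInclusion R hV b := by
          apply Subtype.ext
          change (s : F) = f * b
          rw [← hbs, mul_inv_cancel_left₀ hf0]
        rw [this]
        exact Ideal.mul_mem_left _ _ hb
      · rw [← hbs, mul_inv_cancel_left₀ hf0]
  · rintro ⟨b, s, hs, hbs⟩
    rw [mem_integralClosureCentre, notMem_maximalIdeal] at hs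
    obtain ⟨v, hv⟩ := hs.exists_right_inv
    have : f = (integralClosureInclusion R hV b * v : V) := by
      have h1 : (s : F) * v = 1 := congrArg Subtype.val hv
      change f = b * v
      rw [← hbs, mul_assoc, h1, mul_one]
    rw [this]
    exact Subtype.property _

variable [FiniteDimensional L F] [IsGalois L F]

lemma mem_valuationSubring_iff_of_centre {V₁ V₂ : ValuationSubring F}
    (hV₁ : ∀ r : R, algebraMap R F r ∈ V₁)
    (hm₁ : ∀ r ∈ maximalIdeal R, algebraMap R F r ∈ V₁.nonunits)
    (hV₂ : ∀ r : R, algebraMap R F r ∈ V₂)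
    (hm₂ : ∀ r ∈ maximalIdeal R, algebraMap R F r ∈ V₂.nonunits)
    (g : F ≃ₐ[L] F) (h : integralClosure R F ≃ₐ[R] integralClosure R F)
    (hg : ∀ b, (h b : F) = g b)
    (hmem : ∀ b, h b ∈ integralClosureCentre hV₂ ↔ b ∈ integralClosureCentre hV₁) (f : F) :
    g f ∈ V₂ ↔ f ∈ V₁ := by
  rw [mem_valuationSubring_iff (L := L) hV₁ hm₁, mem_valuationSubring_iff (L := L) hV₂ hm₂]
  constructor
  · rintro ⟨b, s, hs, hbs⟩
    obtain ⟨b, rfl⟩ := h.surjective b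
    obtain ⟨s, rfl⟩ := h.surjective s
    refine ⟨b, s, mt (hmem s).mpr hs, g.injective ?_⟩
    rwa [map_mul, ← hg, ← hg]
  · rintro ⟨b, s, hs, hbs⟩
    refine ⟨h b, h s, mt (hmem s).mp hs, ?_⟩
    rw [hg, hg, ← map_mul, hbs]

/-- The Galois group acts transitively on the valuation rings above `R`. -/
lemma exists_algEquiv_mem_iff {V₁ V₂ : ValuationSubring F}
    (hV₁ : ∀ r : R, algebraMap R F r ∈ V₁)
    (hm₁ : ∀ r ∈ maximalIdeal R, algebraMap R F r ∈ V₁.nonunits)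
    (hV₂ : ∀ r : R, algebraMap R F r ∈ V₂)
    (hm₂ : ∀ r ∈ maximalIdeal R, algebraMap R F r ∈ V₂.nonunits) :
    ∃ g : F ≃ₐ[L] F, ∀ f, g f ∈ V₂ ↔ f ∈ V₁ := by
  have : IsFractionRing (integralClosure R F) F :=
    integralClosure.isFractionRing_of_finite_extension L F
  have : Finite (integralClosure R F ≃ₐ[R] integralClosure R F) :=
    (galRestrict R L F (integralClosure R F)).toEquiv.finite_iff.mp inferInstance
  have := Algebra.isInvariant_of_isGalois' R L F (integralClosure R F)
  obtain ⟨h, hh⟩ := Algebra.IsInvariant.exists_smul_of_under_eq R (integralClosure R F)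
    (integralClosure R F ≃ₐ[R] integralClosure R F) (integralClosureCentre hV₁)
    (integralClosureCentre hV₂)
    ((under_integralClosureCentre hV₁ hm₁).trans (under_integralClosureCentre hV₂ hm₂).symm)
  obtain ⟨g, rfl⟩ := (galRestrict R L F (integralClosure R F)).surjective h
  have hg : ∀ b : integralClosure R F,
      ((galRestrict R L F (integralClosure R F) g b : integralClosure R F) : F) = g b :=
    fun b => algebraMap_galRestrict_apply R g b
  have hmem : ∀ b : integralClosure R F,
      galRestrict R L F (integralClosure R F) g b ∈ integralClosureCentre hV₂ ↔
        b ∈ integralClosureCentre hV₁ := by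
    intro b
    rw [hh]
    exact Ideal.smul_mem_pointwise_smul_iff
  exact ⟨g, mem_valuationSubring_iff_of_centre hV₁ hm₁ hV₂ hm₂ g _ hg hmem⟩

/-- The decomposition group surjects onto the automorphism group of the residue field extension. -/
lemma exists_algEquiv_residue_eq (hV : ∀ r : R, algebraMap R F r ∈ V)
    (hm : ∀ r ∈ maximalIdeal R, algebraMap R F r ∈ V.nonunits)
    (θ : ResidueField V ≃+* ResidueField V)
    (hθ : ∀ r : R, θ (residue V ⟨algebraMap R F r, hV r⟩) = residue V ⟨algebraMap R F r, hV r⟩) :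
    ∃ g : F ≃ₐ[L] F, (∀ f, g f ∈ V ↔ f ∈ V) ∧
      ∀ v v' : V, (v' : F) = g v → residue V v' = θ (residue V v) := by
  have : IsFractionRing (integralClosure R F) F :=
    integralClosure.isFractionRing_of_finite_extension L F
  have : Finite (integralClosure R F ≃ₐ[R] integralClosure R F) :=
    (galRestrict R L F (integralClosure R F)).toEquiv.finite_iff.mp inferInstance
  have := Algebra.isInvariant_of_isGalois' R L F (integralClosure R F)
  set Q := integralClosureCentre hV with hQdef
  have : Q.LiesOver (maximalIdeal R) := ⟨(under_integralClosureCentre hV hm).symm⟩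
  have hQmax : Q.IsMaximal := by
    refine Ideal.isMaximal_of_isIntegral_of_isMaximal_comap (R := R) Q ?_
    have := under_integralClosureCentre hV hm
    rw [Ideal.under] at this
    rw [this]
    infer_instance
  have hsurj : Function.Surjective ((residue V).comp (integralClosureInclusion R hV)) := by
    intro y
    obtain ⟨⟨f, hf⟩, rfl⟩ := residue_surjective y
    obtain ⟨b, s, hs, hbs⟩ := (mem_valuationSubring_iff (L := L) hV hm f).mp hf
    obtain ⟨s', i, hi, hs'⟩ := hQmax.exists_inv hs
    have h1 : (⟨f, hf⟩ : V) * integralClosureInclusion R hV s = integralClosureInclusion R hV b :=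
      Subtype.ext hbs
    have h2 : residue V (integralClosureInclusion R hV s') *
        residue V (integralClosureInclusion R hV s) = 1 := by
      have := congrArg ((residue V).comp (integralClosureInclusion R hV)) hs'
      rwa [map_add, map_mul, map_one, RingHom.mem_ker.mp hi, add_zero] at this
    refine ⟨b * s', ?_⟩
    rw [map_mul, RingHom.comp_apply, RingHom.comp_apply, ← h1, map_mul, mul_assoc,
      mul_comm (residue V _) (residue V (integralClosureInclusion R hV s')), h2, mul_one]
  let ε : (integralClosure R F ⧸ Q) ≃+* ResidueField V :=
    RingHom.quotientKerEquivOfSurjective hsurj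
  have hε : ∀ b, ε (Ideal.Quotient.mk Q b) = residue V (integralClosureInclusion R hV b) :=
    fun b => rfl
  let θ' : (integralClosure R F ⧸ Q) ≃ₐ[R ⧸ maximalIdeal R] (integralClosure R F ⧸ Q) :=
    AlgEquiv.ofRingEquiv (f := (ε.trans θ).trans ε.symm) (by
      intro r
      obtain ⟨r, rfl⟩ := Ideal.Quotient.mk_surjective r
      have hr : algebraMap (R ⧸ maximalIdeal R) (integralClosure R F ⧸ Q)
        (Ideal.Quotient.mk _ r) = Ideal.Quotient.mk Q (algebraMap R _ r) := rfl
      rw [hr]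
      simp only [RingEquiv.trans_apply]
      rw [RingEquiv.symm_apply_eq, hε]
      exact hθ r)
  obtain ⟨⟨h, hh⟩, hθ'⟩ := Ideal.Quotient.stabilizerHom_surjective
    (integralClosure R F ≃ₐ[R] integralClosure R F) (maximalIdeal R) Q θ'
  obtain ⟨g, rfl⟩ := (galRestrict R L F (integralClosure R F)).surjective h
  have hg : ∀ b : integralClosure R F,
      ((galRestrict R L F (integralClosure R F) g b : integralClosure R F) : F) = g b :=
    fun b => algebraMap_galRestrict_apply R g b
  have hmem : ∀ b : integralClosure R F,
      galRestrict R L F (integralClosure R F) g b ∈ Q ↔ b ∈ Q := by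
    intro b
    conv_lhs => rw [← MulAction.mem_stabilizer_iff.mp hh]
    exact Ideal.smul_mem_pointwise_smul_iff
  have hres : ∀ b : integralClosure R F,
      residue V (integralClosureInclusion R hV (galRestrict R L F (integralClosure R F) g b)) =
        θ (residue V (integralClosureInclusion R hV b)) := by
    intro b
    have := DFunLike.congr_fun hθ' (Ideal.Quotient.mk Q b)
    have h2 : ε (θ' (Ideal.Quotient.mk Q b)) = θ (ε (Ideal.Quotient.mk Q b)) := by
      simp [θ']
    rw [← this] at h2
    exact h2
  have hfwd : ∀ f, g f ∈ V ↔ f ∈ V :=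
    mem_valuationSubring_iff_of_centre hV hm hV hm g _ hg hmem
  refine ⟨g, hfwd, ?_⟩
  rintro ⟨f, hf⟩ v' hv'
  obtain ⟨b, s, hs, hbs⟩ := (mem_valuationSubring_iff (L := L) hV hm f).mp hf
  have h1 : (⟨f, hf⟩ : V) * integralClosureInclusion R hV s = integralClosureInclusion R hV b :=
    Subtype.ext hbs
  have h2 : v' * integralClosureInclusion R hV (galRestrict R L F (integralClosure R F) g s) =
      integralClosureInclusion R hV (galRestrict R L F (integralClosure R F) g b) := by
    apply Subtype.ext
    change (v' : F) * (galRestrict R L F (integralClosure R F) g s : integralClosure R F) =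
      (galRestrict R L F (integralClosure R F) g b : integralClosure R F)
    rw [hg, hg, hv', ← map_mul]
    exact congrArg g hbs
  apply_fun residue V at h1 h2
  rw [map_mul] at h1 h2
  rw [hres, hres, ← h1, map_mul] at h2
  refine mul_right_cancel₀ ?_ h2
  rw [Ne, map_eq_zero, residue_eq_zero_iff, ← mem_integralClosureCentre hV]
  exact hs

end Extension

/-! ### Embedding an extension into a complete field -/

section Embedding

open IsLocalRing

/-- An automorphism `β` of `Ω` which preserves `L` and is trivial on the image of `M` induces an
automorphism of the compositum of `L` and `M`. -/
lemma exists_algEquiv_of_fixes {K L M F Ω : Type*} [Field K] [Field L] [Field M] [Field F]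
    [Field Ω] [Algebra K L] [Algebra K M] [Algebra K F] [Algebra L F] [Algebra M F]
    [IsScalarTower K L F] [IsScalarTower K M F] [Algebra L Ω] [FiniteDimensional K L] [IsGalois K L]
    (h : IntermediateField.adjoin L (Set.range (algebraMap M F)) = ⊤)
    (h' : IntermediateField.adjoin M (Set.range (algebraMap L F)) = ⊤)
    (e : F →ₐ[L] Ω) (β : Ω ≃+* Ω)
    (hβL : ∀ l : L, β (algebraMap L Ω l) ∈ (algebraMap L Ω).range)
    (hβM : ∀ m : M, β (e (algebraMap M F m)) = e (algebraMap M F m)) :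
    ∃ σ : F ≃ₐ[M] F, ∀ f, e (σ f) = β (e f) := by
  have := finiteDimensional_of_adjoin_range_eq_top (K := K) h'
  have hmem : ∀ f, β (e f) ∈ (e : F →+* Ω).fieldRange := by
    let E : IntermediateField L F :=
      { ((e : F →+* Ω).fieldRange.comap β.toRingHom).comap (e : F →+* Ω) with
        algebraMap_mem' := fun l => by
          obtain ⟨l', hl'⟩ := hβL l
          refine ⟨algebraMap L F l', ?_⟩
          change e _ = β (e _)
          rw [AlgHom.commutes, AlgHom.commutes, hl'] }
    have hE : E = ⊤ := by
      rw [eq_top_iff, ← h, IntermediateField.adjoin_le_iff]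
      rintro _ ⟨m, rfl⟩
      exact ⟨algebraMap M F m, (hβM m).symm⟩
    intro f
    have : f ∈ E := hE ▸ IntermediateField.mem_top
    exact this
  choose σ hσ using hmem
  change ∀ f, e (σ f) = β (e f) at hσ
  have hinj : Function.Injective e := e.toRingHom.injective
  let σ' : F →ₐ[M] F :=
    { toFun := σ
      map_one' := hinj (by rw [hσ, map_one, map_one])
      map_mul' := fun a b => hinj (by rw [hσ, map_mul, map_mul, map_mul, hσ, hσ])
      map_zero' := hinj (by rw [hσ, map_zero, map_zero])
      map_add' := fun a b => hinj (by rw [hσ, map_add, map_add, map_add, hσ, hσ])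
      commutes' := fun m => hinj (by rw [hσ, hβM]) }
  exact ⟨AlgEquiv.ofBijective σ' (Algebra.IsAlgebraic.algHom_bijective σ'), hσ⟩

variable {K L M F Ω : Type*} [Field K] [Field L] [Field M] [Field F] [Field Ω]
  [Algebra K L] [Algebra K M] [Algebra K F] [Algebra L F] [Algebra M F]
  [IsScalarTower K L F] [IsScalarTower K M F] [Algebra K Ω] [Algebra L Ω] [IsScalarTower K L Ω]
  {R S : Type*} [CommRing R] [IsDomain R] [IsDiscreteValuationRing R] [Algebra R L]
  [IsFractionRing R L] [Algebra R F] [IsScalarTower R L F]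
  [CommRing S] [IsDomain S] [IsDiscreteValuationRing S] [Algebra S Ω] [IsFractionRing S Ω]
  {V : ValuationSubring F}

/-- If a compositum of `L` and a Galois extension `M` of `K` carries a valuation ring `V` above
`R`, and if `M` embeds into a discretely valued extension `Ω` of `L`, then `F` embeds into `Ω` in
such a way that `V` is induced by the valuation ring `S` of `Ω`: all valuation rings of `F` above
`R` are conjugate over `L`. -/
lemma exists_algHom_mem_range_iff [FiniteDimensional K M] [IsGalois K M] (j : M →ₐ[K] Ω)
    (h : IntermediateField.adjoin L (Set.range (algebraMap M F)) = ⊤)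
    (c : R →+* S) [IsLocalHom c]
    (hc : ∀ r, algebraMap L Ω (algebraMap R L r) = algebraMap S Ω (c r))
    (hV : ∀ r : R, algebraMap R F r ∈ V)
    (hm : ∀ r ∈ maximalIdeal R, algebraMap R F r ∈ V.nonunits) :
    ∃ e : F →ₐ[L] Ω, ∀ f, e f ∈ (algebraMap S Ω).range ↔ f ∈ V := by
  have := finiteDimensional_of_adjoin_range_eq_top (K := K) h
  have := isGalois_of_adjoin_range_eq_top (K := K) h
  obtain ⟨e⟩ := nonempty_algHom_of_adjoin_range_eq_top j h
  let V' : ValuationSubring F :=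
    (ValuationRing.valuation S Ω).valuationSubring.comap (e : F →+* Ω)
  have hV' : ∀ f, f ∈ V' ↔ e f ∈ (algebraMap S Ω).range :=
    fun f => ValuationRing.mem_integer_iff _ _ (e f)
  have he : ∀ r, e (algebraMap R F r) = algebraMap S Ω (c r) := by
    intro r
    rw [IsScalarTower.algebraMap_apply R L F, AlgHom.commutes, hc]
  obtain ⟨g, hg⟩ := exists_algEquiv_mem_iff (L := L) hV hm (V₂ := V')
    (fun r => (hV' _).mpr ⟨c r, (he r).symm⟩) (fun r hr => by
      rw [V'.mem_nonunits_iff_or, hV', or_iff_not_imp_left]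
      rintro h0 ⟨s, hs⟩
      have hu : IsUnit (c r) := by
        refine IsUnit.of_mul_eq_one s (IsFractionRing.injective S Ω ?_)
        rw [map_mul, hs, ← he, ← map_mul, mul_inv_cancel₀ h0, map_one, map_one]
      exact hr (isUnit_of_map_unit c r hu))
  exact ⟨e.comp (g : F →ₐ[L] F), fun f => (hV' (g f)).symm.trans (hg f)⟩

section Density

lemma algHom_algebraMap_eq {L F Ω R S : Type*} [Field L] [Field F] [Field Ω] [Algebra L F]
    [Algebra L Ω] [CommRing R] [Algebra R L] [Algebra R F] [IsScalarTower R L F] [CommRing S]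
    [Algebra S Ω] (e : F →ₐ[L] Ω) (c : R →+* S)
    (hc : ∀ r, algebraMap L Ω (algebraMap R L r) = algebraMap S Ω (c r)) (r : R) :
    e (algebraMap R F r) = algebraMap S Ω (c r) := by
  rw [IsScalarTower.algebraMap_apply R L F, AlgHom.commutes, hc]

variable (e : F →ₐ[L] Ω) (he : ∀ f, e f ∈ (algebraMap S Ω).range ↔ f ∈ V)
  (c : R →+* S) (hc : ∀ r, algebraMap L Ω (algebraMap R L r) = algebraMap S Ω (c r))
  {ϖ : R} (hϖ : Irreducible ϖ)
  (hd : ∀ (x : S) (n : ℕ), ∃ (r : R) (y : S), x = c r + c ϖ ^ n * y)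

omit [IsDomain R] [IsDiscreteValuationRing R] [IsDomain S] [IsDiscreteValuationRing S]
  [IsFractionRing S Ω] in
include he hc hϖ hd in
/-- If `R` is dense in `S`, then it is dense in each intermediate valuation ring. -/
lemma exists_eq_algebraMap_add_pow_mul {f : F} (hf : f ∈ V) (n : ℕ) :
    ∃ (r : R), ∃ g ∈ V, f = algebraMap R F r + algebraMap R F ϖ ^ n * g := by
  obtain ⟨x, hx⟩ := (he f).mpr hf
  obtain ⟨r, y, hy⟩ := hd x n
  have h0 : algebraMap R F ϖ ^ n ≠ 0 := by
    refine pow_ne_zero _ ?_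
    rw [IsScalarTower.algebraMap_apply R L F, Ne, map_eq_zero,
      map_eq_zero_iff _ (IsFractionRing.injective R L)]
    exact hϖ.ne_zero
  refine ⟨r, (f - algebraMap R F r) / algebraMap R F ϖ ^ n, (he _).mp ⟨y, ?_⟩, ?_⟩
  · have h1 : e (algebraMap R F ϖ ^ n) ≠ 0 := by rwa [Ne, map_eq_zero]
    rw [map_div₀, eq_div_iff h1, map_sub, ← hx, hy, map_pow, algHom_algebraMap_eq e c hc,
      algHom_algebraMap_eq e c hc, map_add, map_mul, map_pow]
    ring
  · rw [mul_div_cancel₀ _ h0]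
    ring

omit [IsDomain R] [IsDiscreteValuationRing R] in
include he hc hϖ hd in
/-- An automorphism of `F` respecting `V` and its restriction to `R` have the same continuous
extension. -/
lemma map_algHom_eq_of_dense [IsLocalHom c] (σ : F ≃+* F) (hσ : ∀ f ∈ V, σ f ∈ V) (α : R ≃+* R)
    (hα : ∀ r, σ (algebraMap R F r) = algebraMap R F (α r)) (β : Ω →+* Ω)
    (hβ : ∀ x : S, β (algebraMap S Ω x) ∈ (algebraMap S Ω).range)
    (hβα : ∀ r, β (algebraMap S Ω (c r)) = algebraMap S Ω (c (α r))) (f : F) :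
    β (e f) = e (σ f) := by
  have key : ∀ f ∈ V, β (e f) = e (σ f) := by
    intro f hf
    obtain ⟨x, hx⟩ := (he f).mpr hf
    obtain ⟨y, hy⟩ := hβ x
    obtain ⟨z, hz⟩ := (he _).mpr (hσ f hf)
    rw [← hx, ← hy, ← hz]
    congr 1
    rw [← sub_eq_zero]
    refine eq_zero_of_forall_mem_maximalIdeal_pow (s := id) (fun _ => le_rfl) fun n => ?_
    obtain ⟨r, g, hg, hfg⟩ := exists_eq_algebraMap_add_pow_mul e he c hc hϖ hd hf n
    obtain ⟨x', hx'⟩ := (he g).mpr hg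
    obtain ⟨y', hy'⟩ := hβ x'
    obtain ⟨z', hz'⟩ := (he _).mpr (hσ g hg)
    have : y - z = c (α ϖ) ^ n * (y' - z') := by
      apply IsFractionRing.injective S Ω
      rw [map_sub, map_mul, map_pow, map_sub, hy, hz, hy', hz', hx, hx', hfg]
      simp only [map_add, map_mul, map_pow, hα, algHom_algebraMap_eq e c hc, hβα]
      ring
    rw [this]
    refine Ideal.mul_mem_right _ _ (Ideal.pow_mem_pow ?_ n)
    intro hu
    exact hϖ.not_isUnit ((MulEquiv.isUnit_map α).mp (isUnit_of_map_unit c _ hu))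
  rcases V.mem_or_inv_mem f with hf | hf
  · exact key f hf
  · have := key _ hf
    simpa only [map_inv₀, inv_inj] using this

end Density

/-- Artin's theorem: an automorphism fixing the fixed field of a finite group of automorphisms
belongs to the group. -/
lemma exists_eq_of_fixes_fixedPoints {N : Type*} [Group N] [Finite N] (ρ : N →* RingAut Ω)
    (β : RingAut Ω) (hβ : ∀ a, (∀ n, ρ n a = a) → β a = a) : ∃ n, ρ n = β := by
  let : MulSemiringAction N Ω := MulSemiringAction.compHom Ω ρ
  obtain ⟨n, hn⟩ := FixedPoints.toAlgAut_surjective N Ω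
    (AlgEquiv.ofRingEquiv (f := β) fun a => hβ a fun n => a.2 n)
  exact ⟨n, RingEquiv.ext fun a => DFunLike.congr_fun hn a⟩

end Embedding

/-! ### Homomorphisms of local rings and of function fields -/

lemma finiteDimensional_of_isFractionRing {A B K L : Type*} [CommRing A] [CommRing B] [Field K]
    [Field L] [Algebra A B] [Algebra A K] [Algebra A L] [Algebra B L] [Algebra K L]
    [IsScalarTower A B L] [IsScalarTower A K L] [IsDomain B] [IsFractionRing B L]
    [Module.Finite A B] : FiniteDimensional K L := by
  obtain ⟨s, hs⟩ := Module.Finite.fg_top (R := A) (M := B)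
  have hint : ∀ b : B, IsIntegral K (algebraMap B L b) := fun b =>
    ((Algebra.IsIntegral.isIntegral (R := A) b).map (IsScalarTower.toAlgHom A B L)).tower_top
  let E := IntermediateField.adjoin K ((algebraMap B L) '' (s : Set B))
  have : FiniteDimensional K E := IntermediateField.finiteDimensional_adjoin (by
    rintro _ ⟨b, -, rfl⟩
    exact hint b)
  have hB : ∀ b : B, algebraMap B L b ∈ E := by
    intro b
    have hb : b ∈ Submodule.span A (s : Set B) := hs ▸ Submodule.mem_top
    induction hb using Submodule.span_induction with
    | mem x hx => exact IntermediateField.subset_adjoin K _ ⟨x, hx, rfl⟩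
    | zero => rw [map_zero]; exact zero_mem _
    | add x y _ _ hx hy => rw [map_add]; exact add_mem hx hy
    | smul a x _ hx =>
      rw [Algebra.smul_def, map_mul, ← IsScalarTower.algebraMap_apply,
        IsScalarTower.algebraMap_apply A K L]
      exact mul_mem (E.algebraMap_mem _) hx
  have hE : E = ⊤ := by
    rw [eq_top_iff]
    intro x _
    obtain ⟨b, s, -, rfl⟩ := IsFractionRing.div_surjective B x
    exact div_mem (hB b) (hB s)
  rw [hE] at this
  exact IntermediateField.topEquiv.toLinearEquiv.finiteDimensional

section LocalMaps

variable {X Y Z : Scheme.{u}}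

lemma localMap_comp (f : X ⟶ Y) (g : Y ⟶ Z) (h : X ⟶ Z) (hfg : h = f ≫ g) {x : X} {y : Y} {z : Z}
    (hxy : f x = y) (hyz : g y = z) (hxz : h x = z) (a : Z.presheaf.stalk z) :
    localMap h hxz a = localMap f hxy (localMap g hyz a) := by
  subst hfg hxy hyz
  simp only [localMap, TopCat.Presheaf.stalkCongr_hom, Scheme.Hom.stalkMap_comp]
  simp

lemma localMap_germ (f : X ⟶ Y) {x : X} {y : Y} (h : f x = y) (U : Y.Opens) (hy : y ∈ U)
    (a : Γ(Y, U)) :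
    localMap f h (Y.presheaf.germ U y hy a) =
      X.presheaf.germ (f ⁻¹ᵁ U) x (by subst h; exact hy) (f.app U a) := by
  subst h
  simp [localMap]

lemma SpecMap_localMap_fromSpecStalk (f : X ⟶ Y) {x : X} {y : Y} (h : f x = y) :
    Spec.map (CommRingCat.ofHom (localMap f h)) ≫ Y.fromSpecStalk y = X.fromSpecStalk x ≫ f := by
  subst h
  simp [localMap]

variable [IsIntegral X] [IsIntegral Y] [IsIntegral Z]

lemma algebraMap_localMap (f : X ⟶ Y) [IsDominant f] {x : X} {y : Y} (h : f x = y)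
    (a : Y.presheaf.stalk y) :
    functionFieldMap f (algebraMap _ Y.functionField a) =
      algebraMap _ X.functionField (localMap f h a) := by
  obtain ⟨U, hy, a, rfl⟩ := Y.presheaf.exists_germ_eq a
  have : Nonempty U := ⟨⟨y, hy⟩⟩
  have : Nonempty (f ⁻¹ᵁ U) := ⟨⟨x, by subst h; exact hy⟩⟩
  rw [Scheme.algebraMap_germ_eq_germToFunctionField, localMap_germ,
    Scheme.algebraMap_germ_eq_germToFunctionField]
  exact localMap_germ f _ U _ a

lemma functionFieldMap_comp (f : X ⟶ Y) (g : Y ⟶ Z) (h : X ⟶ Z) (hfg : h = f ≫ g) [IsDominant f]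
    [IsDominant g] [IsDominant h] (a : Z.functionField) :
    functionFieldMap h a = functionFieldMap f (functionFieldMap g a) :=
  localMap_comp f g h hfg _ _ _ a

/-- The function field of a finite cover is a finite extension. -/
instance finiteDimensional_coverField (f : X ⟶ Y) [IsFinite f] [IsDominant f] :
    FiniteDimensional Y.functionField (CoverField f) := by
  obtain ⟨_, ⟨U, hU, rfl⟩, hη, -⟩ := Y.isBasis_affineOpens.exists_subset_of_mem_open
    (Set.mem_univ (genericPoint Y)) isOpen_univ
  have : Nonempty U := ⟨⟨_, hη⟩⟩
  have hη' : genericPoint X ∈ f ⁻¹ᵁ U := by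
    change f (genericPoint X) ∈ U
    rwa [apply_genericPoint_of_isDominant]
  have : Nonempty (f ⁻¹ᵁ U) := ⟨⟨_, hη'⟩⟩
  have hfr := functionField_isFractionRing_of_isAffineOpen Y U hU
  have hfr' := functionField_isFractionRing_of_isAffineOpen X _ (hU.preimage f)
  let : Algebra Γ(Y, U) Γ(X, f ⁻¹ᵁ U) := (f.app U).hom.toAlgebra
  have : Module.Finite Γ(Y, U) Γ(X, f ⁻¹ᵁ U) := f.finite_app U hU
  let : Algebra Γ(X, f ⁻¹ᵁ U) (CoverField f) :=
    inferInstanceAs (Algebra Γ(X, f ⁻¹ᵁ U) X.functionField)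
  have : IsFractionRing Γ(X, f ⁻¹ᵁ U) (CoverField f) := hfr'
  let : Algebra Γ(Y, U) (CoverField f) :=
    ((algebraMap Γ(X, f ⁻¹ᵁ U) (CoverField f)).comp (f.app U).hom).toAlgebra
  have : IsScalarTower Γ(Y, U) Γ(X, f ⁻¹ᵁ U) (CoverField f) := .of_algebraMap_eq fun _ => rfl
  have : IsScalarTower Γ(Y, U) Y.functionField (CoverField f) := .of_algebraMap_eq fun a =>
    (localMap_germ f (apply_genericPoint_of_isDominant f) U hη a).symm
  exact finiteDimensional_of_isFractionRing (A := Γ(Y, U)) (B := Γ(X, f ⁻¹ᵁ U))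

/-- A finite dominant morphism of integral schemes has only the generic point above the generic
point. -/
lemma eq_genericPoint_of_apply_eq (f : X ⟶ Y) [IsFinite f] [IsDominant f] {x : X}
    (h : f x = genericPoint Y) : x = genericPoint X := by
  have hd := f.isDiscrete_preimage_singleton (genericPoint Y)
  have hs : genericPoint X ⤳ x := (genericPoint_spec X).specializes trivial
  have := hd.to_subtype
  let a : f ⁻¹' {genericPoint Y} := ⟨genericPoint X, apply_genericPoint_of_isDominant f⟩
  let b : f ⁻¹' {genericPoint Y} := ⟨x, h⟩
  have hab : a ⤳ b := (subtype_specializes_iff _ _).mpr hs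
  exact (congrArg Subtype.val hab.eq).symm

end LocalMaps

section ResidueFields

variable {X Y : Scheme.{u}}

/-- The residue field extensions of a finite morphism are algebraic. -/
lemma isAlgebraic_residueMap (f : X ⟶ Y) [IsFinite f] {x : X} {y : Y} (h : f x = y) :
    letI := (residueMap f h).toAlgebra
    Algebra.IsAlgebraic (IsLocalRing.ResidueField (Y.presheaf.stalk y))
      (IsLocalRing.ResidueField (X.presheaf.stalk x)) := by
  let := (residueMap f h).toAlgebra
  obtain ⟨_, ⟨U, hU, rfl⟩, hy, -⟩ := Y.isBasis_affineOpens.exists_subset_of_mem_open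
    (Set.mem_univ y) isOpen_univ
  have hx : x ∈ f ⁻¹ᵁ U := by subst h; exact hy
  have key : ∀ b : Γ(X, f ⁻¹ᵁ U), IsAlgebraic (IsLocalRing.ResidueField (Y.presheaf.stalk y))
      (IsLocalRing.residue (X.presheaf.stalk x) (X.presheaf.germ _ x hx b)) := by
    intro b
    obtain ⟨p, hp, hpb⟩ := f.isIntegral_app U hU b
    refine IsIntegral.isAlgebraic
      ⟨p.map ((IsLocalRing.residue _).comp (Y.presheaf.germ U y hy).hom), hp.map _, ?_⟩
    have hcomp : (algebraMap (IsLocalRing.ResidueField (Y.presheaf.stalk y))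
        (IsLocalRing.ResidueField (X.presheaf.stalk x))).comp
          ((IsLocalRing.residue _).comp (Y.presheaf.germ U y hy).hom) =
        ((IsLocalRing.residue _).comp (X.presheaf.germ _ x hx).hom).comp (f.app U).hom := by
      refine RingHom.ext fun a => ?_
      change residueMap f h (IsLocalRing.residue _ (Y.presheaf.germ U y hy a)) =
        IsLocalRing.residue _ (X.presheaf.germ _ x hx (f.app U a))
      rw [residueMap, IsLocalRing.ResidueField.map_residue]
      exact congrArg _ (localMap_germ f h U hy a)
    rw [Polynomial.eval₂_map, hcomp]
    have := congrArg ((IsLocalRing.residue _).comp (X.presheaf.germ _ x hx).hom) hpb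
    rwa [Polynomial.hom_eval₂, map_zero] at this
  refine ⟨fun a => ?_⟩
  obtain ⟨a, rfl⟩ := IsLocalRing.residue_surjective a
  let := TopCat.Presheaf.algebra_section_stalk X.presheaf (⟨x, hx⟩ : (f ⁻¹ᵁ U : X.Opens))
  have hloc := (hU.preimage f).isLocalization_stalk ⟨x, hx⟩
  obtain ⟨b, s, hbs⟩ := IsLocalization.exists_mk'_eq
    ((hU.preimage f).primeIdealOf ⟨x, hx⟩).asIdeal.primeCompl a
  have hbs' := IsLocalization.mk'_spec' (X.presheaf.stalk x) b s
  rw [hbs] at hbs'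
  have hs : IsUnit (algebraMap Γ(X, f ⁻¹ᵁ U) (X.presheaf.stalk x) s) :=
    IsLocalization.map_units (X.presheaf.stalk x) s
  have h1 := congrArg (IsLocalRing.residue (X.presheaf.stalk x)) hbs'
  rw [map_mul] at h1
  have h2 := (hs.map (IsLocalRing.residue (X.presheaf.stalk x))).ne_zero
  rw [eq_div_of_mul_eq h2 ((mul_comm _ _).trans h1), div_eq_mul_inv]
  exact IsAlgebraic.mul (key b) (IsAlgebraic.inv (key s))

end ResidueFields

/-! ### Function fields of components of fibre products -/

section Components

/-- A morphism from the spectrum of a field to a scheme, hitting `ξ`, is induced by a homomorphism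
from the residue field at `ξ`. -/
lemma exists_SpecMap_comp_fromSpecResidueField {P : Scheme.{u}} {K : Type u} [Field K]
    (h : Spec (.of K) ⟶ P) {ξ : P} (hξ : h (IsLocalRing.closedPoint K) = ξ) :
    ∃ φ : P.residueField ξ ⟶ .of K, Spec.map φ ≫ P.fromSpecResidueField ξ = h := by
  subst hξ
  exact ⟨_, Scheme.descResidueField_stalkClosedPointTo_fromSpecResidueField K P h⟩

/-- The homomorphism from the function field to a field `K` induced by a morphism from `Spec K`
that hits the generic point. -/
def functionFieldTo {W : Scheme.{u}} [IrreducibleSpace W] {K : CommRingCat.{u}} [IsLocalRing K]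
    (θ : Spec K ⟶ W) (hθ : θ (IsLocalRing.closedPoint K) = genericPoint W) :
    W.functionField ⟶ K :=
  W.presheaf.stalkSpecializes (Specializes.of_eq hθ) ≫ Scheme.stalkClosedPointTo θ

lemma SpecMap_functionFieldTo {W : Scheme.{u}} [IrreducibleSpace W] {K : CommRingCat.{u}}
    [IsLocalRing K] (θ : Spec K ⟶ W) (hθ : θ (IsLocalRing.closedPoint K) = genericPoint W) :
    Spec.map (functionFieldTo θ hθ) ≫ W.fromSpecStalk (genericPoint W) = θ := by
  rw [functionFieldTo, Spec.map_comp, Category.assoc, Scheme.SpecMap_stalkSpecializes_fromSpecStalk,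
    Scheme.Spec_stalkClosedPointTo_fromSpecStalk]

variable {X Y Z W : Scheme.{u}} [IsIntegral X] [IsIntegral Z] [IsIntegral W]

/-- The function field of a component of a normalized fibre product is generated by the function
fields of the factors: for the subfield `F₀` they generate, `Spec F₀` maps to the fibre product,
so that `F₀` contains the residue field there. -/
lemma subfield_functionField_eq_top (f : X ⟶ Y) (g : Z ⟶ Y) (ν : W ⟶ pullback f g)
    (p : W ⟶ X) (hp : p = ν ≫ pullback.fst f g) (q : W ⟶ Z) (hq : q = ν ≫ pullback.snd f g)
    [IsDominant p] [IsDominant q] {ξ : ↥(pullback f g)}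
    (θ : Spec ((pullback f g).residueField ξ) ⟶ W)
    (hθ : θ ≫ ν = (pullback f g).fromSpecResidueField ξ)
    (hθ' : θ (IsLocalRing.closedPoint ((pullback f g).residueField ξ)) = genericPoint W)
    (F₀ : Subfield W.functionField) (hF₀p : ∀ a, functionFieldMap p a ∈ F₀)
    (hF₀q : ∀ a, functionFieldMap q a ∈ F₀) : F₀ = ⊤ := by
  let i : CommRingCat.of F₀ ⟶ W.functionField := CommRingCat.ofHom F₀.subtype
  let u : Spec W.functionField ⟶ W := W.fromSpecStalk (genericPoint W)
  let a : Spec (.of F₀) ⟶ X :=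
    Spec.map (CommRingCat.ofHom ((functionFieldMap p).codRestrict F₀ hF₀p)) ≫
      X.fromSpecStalk (genericPoint X)
  let b : Spec (.of F₀) ⟶ Z :=
    Spec.map (CommRingCat.ofHom ((functionFieldMap q).codRestrict F₀ hF₀q)) ≫
      Z.fromSpecStalk (genericPoint Z)
  have ha : Spec.map i ≫ a = u ≫ p := by
    rw [← SpecMap_localMap_fromSpecStalk p (apply_genericPoint_of_isDominant p),
      ← Spec.map_comp_assoc]
    rfl
  have hb : Spec.map i ≫ b = u ≫ q := by
    rw [← SpecMap_localMap_fromSpecStalk q (apply_genericPoint_of_isDominant q),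
      ← Spec.map_comp_assoc]
    rfl
  -- `Spec` of a field extension is faithfully flat, hence an epimorphism
  have hepi : Epi (Spec.map i) := by
    have : Flat (Spec.map i) := by
      rw [HasRingHomProperty.Spec_iff (P := @Flat)]
      change Module.Flat F₀ W.functionField
      infer_instance
    have : Surjective (Spec.map i) := ⟨fun y =>
      ⟨IsLocalRing.closedPoint W.functionField, Subsingleton.elim (α := PrimeSpectrum F₀) _ _⟩⟩
    exact Flat.epi_of_flat_of_surjective _
  have hab : a ≫ f = b ≫ g := by
    rw [← cancel_epi (Spec.map i), reassoc_of% ha, reassoc_of% hb, hp, hq]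
    simp only [Category.assoc, pullback.condition]
  -- as `F₀` contains both function fields, the map from the generic point factors over `Spec F₀`
  let h : Spec (.of F₀) ⟶ pullback f g := pullback.lift a b hab
  have hh : Spec.map i ≫ h = u ≫ ν := by
    apply pullback.hom_ext
    · rw [Category.assoc, pullback.lift_fst, ha, hp, Category.assoc]
    · rw [Category.assoc, pullback.lift_snd, hb, hq, Category.assoc]
  let t := functionFieldTo θ hθ'
  have ht : Spec.map t ≫ Spec.map i ≫ h = (pullback f g).fromSpecResidueField ξ := by
    rw [hh, ← hθ, ← SpecMap_functionFieldTo θ hθ', Category.assoc]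
  obtain ⟨φ, hφ⟩ := exists_SpecMap_comp_fromSpecResidueField (K := F₀) h (ξ := ξ) (by
    let pt : ↥(Spec ((pullback f g).residueField ξ)) := IsLocalRing.closedPoint _
    have hpt : (IsLocalRing.closedPoint F₀ : ↥(Spec (.of F₀))) = (Spec.map t ≫ Spec.map i) pt :=
      Subsingleton.elim (α := PrimeSpectrum F₀) _ _
    have hpt' := Scheme.fromSpecResidueField_apply (X := pullback f g) ξ pt
    rw [← ht, ← Category.assoc, Scheme.Hom.comp_apply, ← hpt] at hpt'
    exact hpt')
  -- every element of the residue field at `ξ` comes from `F₀`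
  have hid : φ ≫ i ≫ t = 𝟙 _ := by
    apply Spec.map_injective
    rw [← cancel_mono ((pullback f g).fromSpecResidueField ξ), Spec.map_comp,
      Spec.map_comp, Spec.map_id, Category.id_comp, Category.assoc, Category.assoc, hφ, ht]
  rw [eq_top_iff]
  intro y _
  have hy := DFunLike.congr_fun (congrArg CommRingCat.Hom.hom hid) (t y)
  have hinj : Function.Injective t.hom := RingHom.injective _
  have : (i (φ (t y)) : W.functionField) = y := hinj hy
  rw [← this]
  exact Subtype.property _

end Components

/-! ### Affine pieces of regular curves are Dedekind -/

section Dedekind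

lemma isDedekindDomain_of_isDiscreteValuationRing_atMaximal {A : Type*} [CommRing A] [IsDomain A]
    [IsNoetherianRing A] (h : ∀ m : Ideal A, ∀ _ : m.IsMaximal, ∃ (B : Type _) (_ : CommRing B)
      (_ : IsDomain B) (_ : Algebra A B) (_ : IsLocalization.AtPrime B m),
      IsDiscreteValuationRing B) : IsDedekindDomain A := by
  have : Ring.DimensionLEOne A := ⟨fun {P} hP0 hP => by
    obtain ⟨m, hm, hPm⟩ := P.exists_le_maximal hP.ne_top
    obtain ⟨B, _, _, _, _, _⟩ := h m hm
    have hdisj : Disjoint (m.primeCompl : Set A) P :=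
      Set.disjoint_left.mpr fun a ha haP => ha (hPm haP)
    have hprime := IsLocalization.isPrime_of_isPrime_disjoint m.primeCompl B P hP hdisj
    have hcomap := IsLocalization.under_map_of_isPrime_disjoint m.primeCompl B hP hdisj
    have hne : P.map (algebraMap A B) ≠ ⊥ := by
      intro h0
      refine hP0 (hcomap.symm.trans ?_)
      rw [h0, Ideal.under_def, ← RingHom.ker_eq_comap_bot, ← RingHom.injective_iff_ker_eq_bot]
      exact IsLocalization.injective B m.primeCompl_le_nonZeroDivisors
    have hmax := IsLocalRing.eq_maximalIdeal (hprime.isMaximal hne)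
    have hPm' : P = m := by
      rw [← hcomap, hmax, Ideal.under_def]
      exact IsLocalization.AtPrime.under_maximalIdeal B m
    rwa [hPm']⟩
  have : IsIntegrallyClosed A := IsIntegrallyClosed.of_localization_maximal fun m _ hm => by
    obtain ⟨B, _, _, _, _, _⟩ := h m hm
    exact IsIntegrallyClosed.of_equiv (IsLocalization.algEquiv m.primeCompl B
      (Localization.AtPrime m)).toRingEquiv
  exact {}

variable {Z : Scheme.{u}}

/-- Closed points of an affine open are closed, as schemes locally of finite type over a field are
Jacobson. -/
lemma isClosed_fromSpec_of_isMaximal [JacobsonSpace Z] {V : Z.Opens} (hV : IsAffineOpen V)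
    (P : PrimeSpectrum Γ(Z, V)) (hP : P.asIdeal.IsMaximal) :
    IsClosed ({hV.fromSpec P} : Set Z) := by
  have hcl : IsClosed ({P} : Set (PrimeSpectrum Γ(Z, V))) :=
    (PrimeSpectrum.isClosed_singleton_iff_isMaximal P).mpr hP
  have := hV.fromSpec.isOpenEmbedding.preimage_closedPoints
  exact (this.symm ▸ hcl : P ∈ hV.fromSpec ⁻¹' closedPoints Z)

lemma ClosedPoint.ne_genericPoint [IsRegularCurve Z] (z : ClosedPoint Z) :
    z.1 ≠ genericPoint Z := by
  obtain ⟨z, hz⟩ := z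
  rintro rfl
  have := IsRegularCurve.isDiscreteValuationRing (⟨genericPoint Z, hz⟩ : ClosedPoint Z)
  exact IsDiscreteValuationRing.not_isField _ (Field.toIsField Z.functionField)

lemma isDedekindDomain_of_isRegularCurve [IsRegularCurve Z] [IsLocallyNoetherian Z]
    [JacobsonSpace Z] {V : Z.Opens} (hV : IsAffineOpen V) [Nonempty V] :
    IsDedekindDomain Γ(Z, V) := by
  have : IsNoetherianRing Γ(Z, V) := IsLocallyNoetherian.component_noetherian ⟨V, hV⟩
  refine isDedekindDomain_of_isDiscreteValuationRing_atMaximal fun m hm => ?_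
  let P : PrimeSpectrum Γ(Z, V) := ⟨m, hm.isPrime⟩
  have hz : hV.fromSpec P ∈ V := by
    rw [← SetLike.mem_coe, ← hV.range_fromSpec]
    exact ⟨P, rfl⟩
  let z : V := ⟨hV.fromSpec P, hz⟩
  have hPz : hV.primeIdealOf z = P :=
    hV.fromSpec.isOpenEmbedding.injective (hV.fromSpec_primeIdealOf z)
  let := TopCat.Presheaf.algebra_section_stalk Z.presheaf z
  have hloc := hV.isLocalization_stalk z
  rw [hPz] at hloc
  exact ⟨Z.presheaf.stalk z.1, _, inferInstance, _, hloc,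
    IsRegularCurve.isDiscreteValuationRing ⟨z.1, isClosed_fromSpec_of_isMaximal hV P hm⟩⟩

end Dedekind

section IntegralClosure

variable {Z W : Scheme.{u}} [IsIntegral W] [IsRegularCurve Z]

/-- If `W` is integral over a regular curve and integrally closed in a finite separable extension
of its function field, the sections of `W` over an affine open are finite and form a Dedekind
domain. -/
lemma finite_and_isDedekindDomain_section (q : W ⟶ Z) [IsIntegralHom q] [IsDominant q]
    {V : Z.Opens} (hV : IsAffineOpen V) [Nonempty V] [Nonempty (q ⁻¹ᵁ V)]
    (hcl : ∀ a : W.functionField,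
      ((W.germToFunctionField (q ⁻¹ᵁ V)).hom.comp (q.app V).hom).IsIntegralElem a →
        ∃ b, W.germToFunctionField (q ⁻¹ᵁ V) b = a)
    [FiniteDimensional Z.functionField (CoverField q)]
    [Algebra.IsSeparable Z.functionField (CoverField q)] [IsDedekindDomain Γ(Z, V)] :
    (q.app V).hom.Finite ∧ IsDedekindDomain Γ(W, q ⁻¹ᵁ V) := by
  let : Algebra Γ(Z, V) Γ(W, q ⁻¹ᵁ V) := (q.app V).hom.toAlgebra
  let : Algebra Γ(W, q ⁻¹ᵁ V) (CoverField q) :=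
    inferInstanceAs (Algebra Γ(W, q ⁻¹ᵁ V) W.functionField)
  let : Algebra Γ(Z, V) (CoverField q) :=
    ((W.germToFunctionField (q ⁻¹ᵁ V)).hom.comp (q.app V).hom).toAlgebra
  have : IsScalarTower Γ(Z, V) Γ(W, q ⁻¹ᵁ V) (CoverField q) := .of_algebraMap_eq fun _ => rfl
  have : IsScalarTower Γ(Z, V) Z.functionField (CoverField q) := .of_algebraMap_eq fun a =>
    (localMap_germ q (apply_genericPoint_of_isDominant q) V _ a).symm
  have : IsFractionRing Γ(Z, V) Z.functionField :=
    functionField_isFractionRing_of_isAffineOpen Z V hV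
  have hint : Algebra.IsIntegral Γ(Z, V) Γ(W, q ⁻¹ᵁ V) := ⟨q.isIntegral_app V hV⟩
  have : IsIntegralClosure Γ(W, q ⁻¹ᵁ V) Γ(Z, V) (CoverField q) :=
    { algebraMap_injective := W.germToFunctionField_injective _
      isIntegral_iff := fun {a} => ⟨fun h => hcl a h, by
        rintro ⟨b, rfl⟩
        exact (hint.isIntegral b).algebraMap⟩ }
  exact ⟨IsIntegralClosure.finite Γ(Z, V) Z.functionField (CoverField q) _,
    IsIntegralClosure.isDedekindDomain Γ(Z, V) Z.functionField (CoverField q) _⟩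

/-- A scheme which is integrally closed in a finite separable extension of the function field of a
regular curve is a regular curve. -/
lemma isRegularCurve_of_isIntegralHom [IsLocallyNoetherian Z] [JacobsonSpace Z]
    (q : W ⟶ Z) [IsIntegralHom q] [IsDominant q]
    (hcl : ∀ (V : Z.Opens) (_ : IsAffineOpen V) (_ : Nonempty V) (_ : Nonempty (q ⁻¹ᵁ V))
      (a : W.functionField),
      ((W.germToFunctionField (q ⁻¹ᵁ V)).hom.comp (q.app V).hom).IsIntegralElem a →
        ∃ b, W.germToFunctionField (q ⁻¹ᵁ V) b = a)
    [FiniteDimensional Z.functionField (CoverField q)]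
    [Algebra.IsSeparable Z.functionField (CoverField q)] :
    IsFinite q ∧ IsRegularCurve W := by
  have hne : ∀ V : Z.Opens, Nonempty V → Nonempty (q ⁻¹ᵁ V) := fun V ⟨v⟩ =>
    ⟨⟨genericPoint W, by
      change q (genericPoint W) ∈ V
      rw [apply_genericPoint_of_isDominant]
      exact (genericPoint_spec Z).mem_open_set_iff V.2 |>.mpr ⟨v.1, trivial, v.2⟩⟩⟩
  have key : ∀ (V : Z.Opens) (_ : IsAffineOpen V) (_ : Nonempty V),
      (q.app V).hom.Finite ∧ IsDedekindDomain Γ(W, q ⁻¹ᵁ V) := fun V hV hVne =>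
    have hqV := hne V hVne
    have := isDedekindDomain_of_isRegularCurve hV
    finite_and_isDedekindDomain_section q hV (hcl V hV hVne hqV)
  have hfin : IsFinite q := ⟨fun V hV => by
    by_cases hVne : Nonempty V
    · exact (key V hV hVne).1
    · have hV0 : V = ⊥ := by
        rw [eq_bot_iff]
        exact fun v hv => (hVne ⟨⟨v, hv⟩⟩).elim
      have : Subsingleton Γ(W, q ⁻¹ᵁ V) := by
        subst hV0
        exact inferInstanceAs (Subsingleton Γ(W, ⊥))
      exact RingHom.Finite.of_surjective _ fun b => ⟨0, Subsingleton.elim _ _⟩⟩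
  have : CompactSpace Z := IsRegularCurve.compactSpace
  refine ⟨hfin,
    { isSeparated_terminal_from := ?_, compactSpace := ?_, isDiscreteValuationRing := ?_ }⟩
  · rw [← terminal.comp_from q]
    infer_instance
  · exact QuasiCompact.compactSpace_of_compactSpace q
  · rintro ⟨w, hw⟩
    obtain ⟨_, ⟨V, hV, rfl⟩, hwV, -⟩ := Z.isBasis_affineOpens.exists_subset_of_mem_open
      (Set.mem_univ (q w)) isOpen_univ
    have hVne : Nonempty V := ⟨⟨_, hwV⟩⟩
    have := hne V hVne
    have := (key V hV hVne).2
    have hqV := hV.preimage q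
    let w' : (q ⁻¹ᵁ V : W.Opens) := ⟨w, hwV⟩
    let := TopCat.Presheaf.algebra_section_stalk W.presheaf w'
    have hloc := hqV.isLocalization_stalk w'
    refine IsLocalization.AtPrime.isDiscreteValuationRing_of_dedekind_domain
      Γ(W, q ⁻¹ᵁ V) (P := (hqV.primeIdealOf w').asIdeal) (fun h0 => ?_) (W.presheaf.stalk w)
    have hwη : w = genericPoint W := by
      change w'.1 = _
      rw [← hqV.fromSpec_primeIdealOf w',
        show hqV.primeIdealOf w' = genericPoint (Spec Γ(W, q ⁻¹ᵁ V)) from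
          (PrimeSpectrum.ext h0).trans (genericPoint_eq_bot_of_affine _).symm,
        ← hqV.primeIdealOf_genericPoint, hqV.fromSpec_primeIdealOf]
    have hcl : IsClosed ({q w} : Set Z) := by
      simpa using q.isClosedMap _ hw
    refine ClosedPoint.ne_genericPoint ⟨q w, hcl⟩ ?_
    exact (congrArg q hwη).trans (apply_genericPoint_of_isDominant q)

end IntegralClosure

/-! ### Components of normalized fibre products -/

section Normalization

lemma genericPoint_mem_preimage {S N : Scheme.{u}} [IsIntegral S] [IsIntegral N] (T : S ⟶ N)
    [IsDominant T] (V : N.Opens) [h : Nonempty V] : genericPoint S ∈ T ⁻¹ᵁ V := by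
  change T (genericPoint S) ∈ V
  rw [apply_genericPoint_of_isDominant]
  exact ((genericPoint_spec N).mem_open_set_iff V.2).mpr (by simpa using h)

lemma functionFieldMap_germ {S N : Scheme.{u}} [IsIntegral S] [IsIntegral N] (T : S ⟶ N)
    [IsDominant T] (V : N.Opens) [Nonempty V] [Nonempty (T ⁻¹ᵁ V)] (a : Γ(N, V)) :
    functionFieldMap T (N.germToFunctionField V a) =
      S.germToFunctionField (T ⁻¹ᵁ V) (T.app V a) :=
  localMap_germ T (apply_genericPoint_of_isDominant T) V _ a

/-- The normalization of `P` in an integral scheme `S` is integrally closed in the function field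
of `S`, if the rational functions on `S` are regular. -/
lemma exists_germ_eq_of_isIntegralElem_normalization {S P : Scheme.{u}} (f : S ⟶ P)
    [QuasiCompact f] [QuasiSeparated f] [IsIntegral S] {U : P.Opens} (hU : IsAffineOpen U)
    [Nonempty (f ⁻¹ᵁ U)] [Nonempty (f.fromNormalization ⁻¹ᵁ U)]
    (hS : Function.Surjective (S.germToFunctionField (f ⁻¹ᵁ U)))
    (a : f.normalization.functionField)
    (ha : ((f.normalization.germToFunctionField (f.fromNormalization ⁻¹ᵁ U)).hom.comp
      (f.fromNormalization.app U).hom).IsIntegralElem a) :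
    ∃ b, f.normalization.germToFunctionField (f.fromNormalization ⁻¹ᵁ U) b = a := by
  obtain ⟨y, hy⟩ := hS (functionFieldMap f.toNormalization a)
  let := (f.app U).hom.toAlgebra
  have happ : ∀ b : Γ(f.normalization, f.fromNormalization ⁻¹ᵁ U),
      functionFieldMap f.toNormalization (f.normalization.germToFunctionField _ b) =
        S.germToFunctionField (f ⁻¹ᵁ U) ((f.normalizationObjIso hU).hom b).1 := by
    intro b
    have h1 : ((f.normalizationObjIso hU).hom b).1 = f.toNormalization.appLE _ _ _ b :=
      congr($(f.normalizationObjIso_hom_val hU) b)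
    have : Nonempty (f.toNormalization ⁻¹ᵁ f.fromNormalization ⁻¹ᵁ U) :=
      ⟨⟨_, genericPoint_mem_preimage f.toNormalization _⟩⟩
    rw [h1, functionFieldMap_germ, Scheme.Hom.appLE]
    exact (TopCat.Presheaf.germ_res_apply _ _ _ _ _).symm
  have hcomp : (functionFieldMap f.toNormalization).comp
      ((f.normalization.germToFunctionField (f.fromNormalization ⁻¹ᵁ U)).hom.comp
        (f.fromNormalization.app U).hom) =
      (S.germToFunctionField (f ⁻¹ᵁ U)).hom.comp (f.app U).hom := by
    refine RingHom.ext fun c => ?_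
    refine (happ _).trans ?_
    rw [Scheme.Hom.fromNormalization_app _ hU]
    simp
    rfl
  have hint : IsIntegral Γ(P, U) y := by
    obtain ⟨g, hg, hga⟩ := ha
    refine ⟨g, hg, S.germToFunctionField_injective (f ⁻¹ᵁ U) ?_⟩
    have h1 := congrArg (functionFieldMap f.toNormalization) hga
    rw [Polynomial.hom_eval₂, hcomp, ← hy, map_zero] at h1
    rw [map_zero]
    exact (Polynomial.hom_eval₂ _ _ _ _).trans h1
  refine ⟨(f.normalizationObjIso hU).inv ⟨y, hint⟩, ?_⟩
  apply (functionFieldMap f.toNormalization).injective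
  rw [happ, ← hy]
  simp

lemma surjective_germToFunctionField_Spec (K : Type u) [Field K] (U : (Spec (.of K)).Opens)
    [h : Nonempty U] : Function.Surjective ((Spec (.of K)).germToFunctionField U) := by
  obtain ⟨v⟩ := h
  have hU : U = ⊤ := by
    rw [eq_top_iff]
    intro y _
    exact (Subsingleton.elim (α := PrimeSpectrum K) y v.1) ▸ v.2
  subst hU
  have : Nonempty (⊤ : (Spec (.of K)).Opens) := ⟨v⟩
  have := functionField_isFractionRing_of_isAffineOpen (Spec (.of K)) ⊤ (isAffineOpen_top _)
  let e := (Scheme.ΓSpecIso (.of K)).commRingCatIsoToRingEquiv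
  have hf : IsField Γ(Spec (.of K), ⊤) := e.toMulEquiv.isField (Field.toIsField K)
  exact (IsFractionRing.surjective_iff_isField (R := Γ(Spec (.of K), ⊤))
    (K := (Spec (.of K)).functionField)).mpr hf

lemma isDominant_of_apply_genericPoint {W X : Scheme.{u}} [IsIntegral W] [IsIntegral X]
    (p : W ⟶ X) (h : p (genericPoint W) = genericPoint X) : IsDominant p := by
  refine ⟨dense_iff_closure_eq.mpr (Set.eq_univ_of_univ_subset ?_)⟩
  rw [← (genericPoint_spec X).def, ← h]
  exact closure_mono (by rintro _ rfl; exact ⟨_, rfl⟩)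

lemma surjective_functionFieldMap_of_isIso {W N : Scheme.{u}} [IsIntegral W] [IsIntegral N]
    (e : W ⟶ N) [IsIso e] : Function.Surjective (functionFieldMap e) := by
  unfold functionFieldMap localMap
  exact (ConcreteCategory.bijective_of_isIso _).2

/-- A component of the normalization of `P` is integrally closed in its function field. -/
lemma exists_germ_eq_of_isIntegralElem {P W : Scheme.{u}} [QuasiSeparatedSpace P] [IsIntegral W]
    {ξ : P} (e : W ≅ (P.fromSpecResidueField ξ).normalization) (ν : W ⟶ P)
    (hν : ν = e.hom ≫ (P.fromSpecResidueField ξ).fromNormalization)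
    {U : P.Opens} (hU : IsAffineOpen U) [Nonempty (ν ⁻¹ᵁ U)] (a : W.functionField)
    (ha : ((W.germToFunctionField (ν ⁻¹ᵁ U)).hom.comp (ν.app U).hom).IsIntegralElem a) :
    ∃ b, W.germToFunctionField (ν ⁻¹ᵁ U) b = a := by
  subst hν
  let f := P.fromSpecResidueField ξ
  have hne : Nonempty (f.fromNormalization ⁻¹ᵁ U) := by
    obtain ⟨w⟩ := ‹Nonempty ((e.hom ≫ f.fromNormalization) ⁻¹ᵁ U)›
    exact ⟨⟨e.hom w.1, w.2⟩⟩
  have hne' : Nonempty (f ⁻¹ᵁ U) := by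
    refine ⟨⟨genericPoint _, ?_⟩⟩
    have := genericPoint_mem_preimage f.toNormalization (f.fromNormalization ⁻¹ᵁ U)
    rwa [← Scheme.Hom.comp_preimage, f.toNormalization_fromNormalization] at this
  have hne'' : Nonempty (e.hom ⁻¹ᵁ f.fromNormalization ⁻¹ᵁ U) :=
    ‹Nonempty ((e.hom ≫ f.fromNormalization) ⁻¹ᵁ U)›
  obtain ⟨a, rfl⟩ := surjective_functionFieldMap_of_isIso e.hom a
  obtain ⟨g, hg, hga⟩ := ha
  have hcomp : (functionFieldMap e.hom).comp
      ((f.normalization.germToFunctionField (f.fromNormalization ⁻¹ᵁ U)).hom.comp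
        (f.fromNormalization.app U).hom) =
      (W.germToFunctionField ((e.hom ≫ f.fromNormalization) ⁻¹ᵁ U)).hom.comp
        ((e.hom ≫ f.fromNormalization).app U).hom := by
    refine RingHom.ext fun c => ?_
    refine (functionFieldMap_germ e.hom _ _).trans ?_
    rw [Scheme.Hom.comp_app]
    rfl
  rw [← hcomp, ← Polynomial.hom_eval₂, map_eq_zero] at hga
  obtain ⟨b, rfl⟩ := exists_germ_eq_of_isIntegralElem_normalization f hU
    (surjective_germToFunctionField_Spec _ (h := hne') _) a ⟨g, hg, hga⟩
  exact ⟨e.hom.app _ b, (functionFieldMap_germ e.hom _ b).symm⟩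

variable {k : Type u} [Field k] {X Y Z W : Scheme.{u}}
  [IsRegularCurve X] [IsRegularCurve Y] [IsRegularCurve Z]

/-- A component of the normalized fibre product of two Galois covers, dominating the base, is a
Galois cover of the factors, with function field generated by those of the factors. -/
theorem isGaloisCover_component (s : Y ⟶ Spec (CommRingCat.of k)) [LocallyOfFiniteType s]
    (Φ : X ⟶ Y) [IsGaloisCover Φ] (Ψ : Z ⟶ Y) [IsGaloisCover Ψ]
    (ν : W ⟶ pullback Φ Ψ) (hν : IsComponentOfNormalization ν)
    (hdom : IsDominant (ν ≫ pullback.fst Φ Ψ ≫ Φ))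
    (p : W ⟶ X) (hp : p = ν ≫ pullback.fst Φ Ψ)
    (q : W ⟶ Z) (hq : q = ν ≫ pullback.snd Φ Ψ) :
    ∃ (_ : IsRegularCurve W) (_ : IsDominant p) (_ : IsGaloisCover q),
      ∀ F₀ : Subfield W.functionField, (∀ a, functionFieldMap p a ∈ F₀) →
        (∀ a, functionFieldMap q a ∈ F₀) → F₀ = ⊤ := by
  obtain ⟨ξ, -, e, hν⟩ := hν
  let f := (pullback Φ Ψ).fromSpecResidueField ξ
  have : Nonempty W := ⟨e.inv (genericPoint f.normalization)⟩
  have : IsIntegral W := isIntegral_of_isOpenImmersion e.hom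
  have hηY := apply_genericPoint_of_isDominant (ν ≫ pullback.fst Φ Ψ ≫ Φ)
  have hpη : p (genericPoint W) = genericPoint X := by
    refine eq_genericPoint_of_apply_eq Φ ?_
    rw [← Scheme.Hom.comp_apply, hp, Category.assoc, hηY]
  have hqη : q (genericPoint W) = genericPoint Z := by
    refine eq_genericPoint_of_apply_eq Ψ ?_
    rw [← Scheme.Hom.comp_apply, hq, Category.assoc, ← pullback.condition, hηY]
  have hpd := isDominant_of_apply_genericPoint p hpη
  have hqd := isDominant_of_apply_genericPoint q hqη
  have hqint : IsIntegralHom q := by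
    rw [hq, hν]
    infer_instance
  let θ : Spec ((pullback Φ Ψ).residueField ξ) ⟶ W := f.toNormalization ≫ e.inv
  have hθ : θ ≫ ν = (pullback Φ Ψ).fromSpecResidueField ξ := by
    simp [θ, hν, f]
  have hθ' : θ (IsLocalRing.closedPoint ((pullback Φ Ψ).residueField ξ)) = genericPoint W := by
    rw [← apply_genericPoint_of_isDominant θ]
    exact congrArg θ (Subsingleton.elim (α := PrimeSpectrum ((pullback Φ Ψ).residueField ξ)) _ _)
  have hgen : ∀ F₀ : Subfield W.functionField, (∀ a, functionFieldMap p a ∈ F₀) →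
      (∀ a, functionFieldMap q a ∈ F₀) → F₀ = ⊤ :=
    fun F₀ => subfield_functionField_eq_top Φ Ψ ν p hp q hq θ hθ hθ' F₀
  have hpΦ : p ≫ Φ = q ≫ Ψ := by simp [hp, hq, pullback.condition]
  have hpΦd : IsDominant (p ≫ Φ) := inferInstance
  let : Algebra Y.functionField Z.functionField := (functionFieldMap Ψ).toAlgebra
  let : Algebra Y.functionField (CoverField q) :=
    ((functionFieldMap q).comp (functionFieldMap Ψ)).toAlgebra
  let : Algebra (CoverField Φ) (CoverField q) := (functionFieldMap p).toAlgebra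
  have : IsScalarTower Y.functionField Z.functionField (CoverField q) := .of_algebraMap_eq' rfl
  have : IsScalarTower Y.functionField (CoverField Φ) (CoverField q) := .of_algebraMap_eq fun a =>
    (functionFieldMap_comp q Ψ _ hpΦ a).symm.trans (functionFieldMap_comp p Φ _ rfl a)
  have : IsGalois Y.functionField (CoverField Φ) := IsGaloisCover.isGalois
  have hadj : IntermediateField.adjoin Z.functionField
      (Set.range (algebraMap (CoverField Φ) (CoverField q))) = ⊤ :=
    adjoin_range_eq_top_of_forall_subfield fun F₀ hq hp => hgen F₀ hp hq
  have hfd : FiniteDimensional Z.functionField (CoverField q) :=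
    finiteDimensional_of_adjoin_range_eq_top (K := Y.functionField) hadj
  have hgal : IsGalois Z.functionField (CoverField q) :=
    isGalois_of_adjoin_range_eq_top (K := Y.functionField) hadj
  have hlft : LocallyOfFiniteType (Ψ ≫ s) := inferInstance
  have : IsLocallyNoetherian Z := LocallyOfFiniteType.isLocallyNoetherian (Ψ ≫ s)
  have : JacobsonSpace Z := LocallyOfFiniteType.jacobsonSpace (Ψ ≫ s)
  obtain ⟨hfin, hreg⟩ := isRegularCurve_of_isIntegralHom q fun V hV hVne hqV a ⟨g, hg, hga⟩ => by
    subst hq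
    have : Nonempty (ν ⁻¹ᵁ pullback.snd Φ Ψ ⁻¹ᵁ V) := hqV
    refine exists_germ_eq_of_isIntegralElem e ν hν (hV.preimage (pullback.snd Φ Ψ)) a
      ⟨g.map ((pullback.snd Φ Ψ).app V).hom, hg.map _, ?_⟩
    rw [Polynomial.eval₂_map]
    exact hga
  exact ⟨hreg, hpd, { hfin, hqd with isGalois := hgal }, hgen⟩

end Normalization

/-! ### Actions of the decomposition group -/

section Decomposition

open IsLocalRing
open scoped Pointwise

variable {X Y : Scheme.{u}} {f : X ⟶ Y} [IsRegularCurve X] {x : ClosedPoint X}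

lemma algebraMap_stalk_injective :
    Function.Injective (algebraMap (X.presheaf.stalk x.1) (CoverField f)) :=
  IsFractionRing.injective _ _

lemma algebraMap_mem_nonunits {a : X.presheaf.stalk x.1}
    (ha : a ∈ maximalIdeal (X.presheaf.stalk x.1)) :
    algebraMap _ (CoverField f) a ∈ (localValuationSubring f x).nonunits := by
  rw [← coe_stalkEquiv, ValuationSubring.coe_mem_nonunits_iff, mem_maximalIdeal, mem_nonunits_iff,
    MulEquiv.isUnit_map]
  exact ha

variable [IsIntegral Y] [IsDominant f]

lemma mem_decompositionGroup_iff (σ : CoverGroup f) :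
    σ ∈ decompositionGroup f x ↔
      ∀ a, σ a ∈ localValuationSubring f x ↔ a ∈ localValuationSubring f x := by
  rw [decompositionGroup, ValuationSubring.decompositionSubgroup, MulAction.mem_stabilizer_iff,
    SetLike.ext_iff]
  constructor
  · intro h a
    rw [← h (σ a)]
    exact ValuationSubring.smul_mem_pointwise_smul_iff (g := σ) (x := a)
  · intro h a
    obtain ⟨a, rfl⟩ := σ.surjective a
    rw [h]
    exact ValuationSubring.smul_mem_pointwise_smul_iff (g := σ) (x := a)

lemma stalkAut_mul (σ τ : decompositionGroup f x) (a : X.presheaf.stalk x.1) :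
    stalkAut (σ * τ) a = stalkAut σ (stalkAut τ a) := by
  apply algebraMap_stalk_injective (f := f)
  simp only [algebraMap_stalkAut]
  rfl

lemma stalkAut_one (a : X.presheaf.stalk x.1) :
    stalkAut (1 : decompositionGroup f x) a = a := by
  apply algebraMap_stalk_injective (f := f)
  simp only [algebraMap_stalkAut]
  rfl

lemma residueAut_residue (σ : decompositionGroup f x) (a : X.presheaf.stalk x.1) :
    residueAut σ (residue _ a) = residue _ (stalkAut σ a) := rfl

lemma residueAut_mul (σ τ : decompositionGroup f x) (a : ResidueField (X.presheaf.stalk x.1)) :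
    residueAut (σ * τ) a = residueAut σ (residueAut τ a) := by
  obtain ⟨a, rfl⟩ := residue_surjective a
  simp only [residueAut_residue, stalkAut_mul]

lemma mem_inertiaGroup_iff (σ : decompositionGroup f x) :
    σ ∈ inertiaGroup f x ↔ ∀ a, residueAut σ a = a := by
  have key : ∀ a : X.presheaf.stalk x.1,
      MulSemiringAction.toRingAut (decompositionGroup f x)
        (ResidueField (localValuationSubring f x)) σ (residue _ (stalkEquiv f x a)) =
      ResidueField.mapEquiv (stalkEquiv f x) (residueAut σ (residue _ a)) := by
    intro a
    rw [residueAut_residue]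
    change residue _ (σ • stalkEquiv f x a) = residue _ (stalkEquiv f x (stalkAut σ a))
    simp [stalkAut]
  rw [inertiaGroup, ValuationSubring.inertiaSubgroup, MonoidHom.mem_ker]
  constructor
  · intro h a
    obtain ⟨a, rfl⟩ := residue_surjective a
    apply (ResidueField.mapEquiv (stalkEquiv f x)).injective
    rw [← key, h]
    rfl
  · intro h
    refine RingEquiv.ext fun a => ?_
    obtain ⟨a, rfl⟩ := residue_surjective a
    obtain ⟨a, rfl⟩ := (stalkEquiv f x).surjective a
    rw [key, h]
    rfl

lemma completedAut_algebraMap (σ : decompositionGroup f x)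
    (a : CompletedRing (X.presheaf.stalk x.1)) :
    completedAut σ (algebraMap _ _ a) =
      algebraMap _ _ (completedMap (stalkAut σ : _ →+* X.presheaf.stalk x.1) a) :=
  IsFractionRing.ringEquivOfRingEquiv_algebraMap _ a

lemma completedAut_algebraMap_algebraMap (σ : decompositionGroup f x)
    (a : X.presheaf.stalk x.1) :
    completedAut σ (algebraMap (CompletedRing (X.presheaf.stalk x.1)) _ (algebraMap _ _ a)) =
      algebraMap (CompletedRing (X.presheaf.stalk x.1)) _ (algebraMap _ _ (stalkAut σ a)) := by
  rw [completedAut_algebraMap, completedMap_algebraMap]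
  rfl

lemma completedAut_injective :
    Function.Injective (completedAut : decompositionGroup f x → _) := by
  intro σ τ h
  have hR : ∀ a : X.presheaf.stalk x.1, stalkAut σ a = stalkAut τ a := by
    intro a
    apply algebraMap_completedRing_injective
    apply IsFractionRing.injective _ (CompletedField (X.presheaf.stalk x.1))
    rw [← completedAut_algebraMap_algebraMap, h, completedAut_algebraMap_algebraMap]
  refine Subtype.ext (AlgEquiv.ext fun a => ?_)
  obtain ⟨a, b, -, rfl⟩ := IsFractionRing.div_surjective (X.presheaf.stalk x.1) a
  simp only [map_div₀, ← algebraMap_stalkAut, hR]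

/-- The action of the decomposition group on `QF(𝒪̂_{X,x})`, as a homomorphism. -/
def completedAutHom :
    decompositionGroup f x →* RingAut (CompletedField (X.presheaf.stalk x.1)) where
  toFun := completedAut
  map_one' := by
    refine RingEquiv.ext fun a => ?_
    obtain ⟨a, b, -, rfl⟩ := IsFractionRing.div_surjective
      (CompletedRing (X.presheaf.stalk x.1)) a
    have h := completedMap_id ((stalkAut (1 : decompositionGroup f x) :
      X.presheaf.stalk x.1 →+* X.presheaf.stalk x.1)) (RingHom.ext stalkAut_one)
    simp only [map_div₀, completedAut_algebraMap, h]
    rfl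
  map_mul' σ τ := by
    refine RingEquiv.ext fun a => ?_
    obtain ⟨a, b, -, rfl⟩ := IsFractionRing.div_surjective
      (CompletedRing (X.presheaf.stalk x.1)) a
    have h := completedMap_completedMap (stalkAut τ : _ →+* X.presheaf.stalk x.1)
      (stalkAut σ : _ →+* X.presheaf.stalk x.1) (stalkAut (σ * τ) : _ →+* X.presheaf.stalk x.1)
      (RingHom.ext fun a => (stalkAut_mul σ τ a).symm)
    rw [RingAut.mul_apply]
    simp only [map_div₀, completedAut_algebraMap, h]

/-- Artin's theorem for the action of the decomposition group on `QF(𝒪̂_{X,x})`. -/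
lemma mem_of_forall_completedFixedField [IsFinite f] (N : Subgroup (decompositionGroup f x))
    (σ : decompositionGroup f x) (h : ∀ a ∈ completedFixedField N, completedAut σ a = a) :
    σ ∈ N := by
  obtain ⟨n, hn⟩ := exists_eq_of_fixes_fixedPoints (completedAutHom.comp N.subtype)
    (completedAut σ) fun a ha => h a ((mem_completedFixedField N a).mpr fun τ hτ => ha ⟨τ, hτ⟩)
  have : (n : decompositionGroup f x) = σ := completedAut_injective hn
  exact this ▸ n.2

end Decomposition

/-! ### Homomorphisms between fraction fields of completions -/

section CompletedFields

open IsLocalRing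

instance henselianLocalRing_completedRing (S : Type u) [CommRing S] [IsDomain S]
    [IsDiscreteValuationRing S] : HenselianLocalRing (CompletedRing S) where
  is_henselian g hg a₀ h h' :=
    (inferInstance : HenselianRing (CompletedRing S) (maximalIdeal _)).is_henselian g hg a₀ h
      (h'.map _)

/-- A homomorphism from the fraction field of a Henselian discrete valuation ring to that of another
discrete valuation ring is local as soon as it maps some nonzero element to the maximal ideal. -/
lemma exists_mem_maximalIdeal_of_henselian {A E₁ B E₂ : Type*} [CommRing A] [IsDomain A]
    [IsDiscreteValuationRing A] [HenselianLocalRing A] [Field E₁] [Algebra A E₁]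
    [IsFractionRing A E₁] [CommRing B] [IsDomain B] [IsDiscreteValuationRing B] [Field E₂]
    [Algebra B E₂] [IsFractionRing B E₂] (ι : E₁ →+* E₂) {a : A} (ha : a ≠ 0) {b : B}
    (hb : b ∈ maximalIdeal B) (hab : ι (algebraMap A E₁ a) = algebraMap B E₂ b)
    {x : A} (hx : x ∈ maximalIdeal A) :
    ∃ y ∈ maximalIdeal B, ι (algebraMap A E₁ x) = algebraMap B E₂ y := by
  obtain ⟨ϖ, hϖ⟩ := IsDiscreteValuationRing.exists_irreducible A
  obtain ⟨n, u, rfl⟩ := IsDiscreteValuationRing.eq_unit_mul_pow_irreducible ha hϖ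
  rw [(IsDiscreteValuationRing.irreducible_iff_uniformizer ϖ).mp hϖ,
    Ideal.mem_span_singleton] at hx
  obtain ⟨x, rfl⟩ := hx
  obtain ⟨y, hy⟩ := mem_range_of_henselian (B := B) ι (ϖ * x)
  refine ⟨y, ?_, hy.symm⟩
  obtain ⟨z, hz⟩ := mem_range_of_henselian (B := B) ι (((u⁻¹ : Aˣ) : A) * x ^ n)
  have hyn : y ^ n = b * z := by
    apply IsFractionRing.injective B E₂
    rw [map_pow, hy, map_mul (algebraMap B E₂), hz, ← hab, ← map_pow, ← map_pow, ← map_mul,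
      ← map_mul]
    congr 2
    rw [mul_pow]
    linear_combination (-(ϖ ^ n * x ^ n)) * u.mul_inv
  exact (Ideal.IsPrime.mem_of_pow_mem inferInstance n (hyn ▸ Ideal.mul_mem_right z _ hb))

variable {R S : Type u} [CommRing R] [IsDomain R] [IsDiscreteValuationRing R] [CommRing S]
  [IsDomain S] [IsDiscreteValuationRing S]

/-- A continuous automorphism of `QF(R̂)` which is trivial on the image of `S` is trivial on the
image of `QF(Ŝ)`. -/
lemma map_eq_of_forall_map_algebraMap_eq (ι : CompletedField S →+* CompletedField R)
    {a : CompletedRing S} (ha : a ≠ 0) {b : CompletedRing R}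
    (hb : b ∈ maximalIdeal (CompletedRing R)) (hab : ι (algebraMap _ _ a) = algebraMap _ _ b)
    (α : R →+* R) [IsLocalHom α] (β : CompletedField R →+* CompletedField R)
    (hβ : ∀ x : CompletedRing R, β (algebraMap _ _ x) = algebraMap _ _ (completedMap α x))
    (hS : ∀ s : S, β (ι (algebraMap (CompletedRing S) _ (algebraMap S _ s))) =
      ι (algebraMap (CompletedRing S) _ (algebraMap S _ s))) (y : CompletedField S) :
    β (ι y) = ι y := by
  have key : ∀ x : CompletedRing S, β (ι (algebraMap _ _ x)) = ι (algebraMap _ _ x) := by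
    intro x
    obtain ⟨y, hy⟩ := mem_range_of_henselian (B := CompletedRing R) ι x
    rw [← hy, hβ]
    congr 1
    rw [← sub_eq_zero]
    refine eq_zero_of_forall_mem_maximalIdeal_pow (s := id) (fun _ => le_rfl) fun n => ?_
    -- modulo `𝔪 ^ n`, the image of `x` is that of an element `s` of `S`
    obtain ⟨s, hs⟩ := exists_sub_algebraMap_mem_maximalIdeal_pow x n
    obtain ⟨ϖ, hϖ⟩ := IsDiscreteValuationRing.exists_irreducible (CompletedRing S)
    rw [(IsDiscreteValuationRing.irreducible_iff_uniformizer ϖ).mp hϖ, Ideal.span_singleton_pow,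
      Ideal.mem_span_singleton] at hs
    obtain ⟨x', hx'⟩ := hs
    obtain ⟨t, ht, hϖt⟩ := exists_mem_maximalIdeal_of_henselian ι ha hb hab
      (x := ϖ) hϖ.not_isUnit
    obtain ⟨y', hy'⟩ := mem_range_of_henselian (B := CompletedRing R) ι x'
    obtain ⟨c, hc⟩ := mem_range_of_henselian (B := CompletedRing R) ι
      (algebraMap S (CompletedRing S) s)
    have hyc : y = c + t ^ n * y' := by
      apply IsFractionRing.injective (CompletedRing R) (CompletedField R)
      rw [hy, ← sub_add_cancel x (algebraMap S (CompletedRing S) s), hx']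
      simp only [map_add, map_mul, map_pow, hc, hϖt, hy']
      ring
    have hcc : completedMap α c = c := by
      apply IsFractionRing.injective (CompletedRing R) (CompletedField R)
      rw [← hβ, hc, hS]
    have htn : t ^ n * y' ∈ maximalIdeal (CompletedRing R) ^ n :=
      Ideal.mul_mem_right _ _ (Ideal.pow_mem_pow ht n)
    have : completedMap α y - y = completedMap α (t ^ n * y') - t ^ n * y' := by
      rw [hyc, map_add, hcc]
      ring
    rw [this]
    exact sub_mem (completedMap_mem_maximalIdeal_pow α htn) htn
  obtain ⟨y, z, -, rfl⟩ := IsFractionRing.div_surjective (CompletedRing S) y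
  rw [map_div₀, map_div₀, key, key]

end CompletedFields

section Covers

open IsLocalRing

/-- An element of the inertia group acts trivially on a compatible coefficient field. -/
lemma completedMap_stalkAut_top {X Y : Scheme.{u}} {f : X ⟶ Y} [IsRegularCurve X] [IsIntegral Y]
    [IsFinite f] [IsDominant f] {x : ClosedPoint X} {y : Y} (h : f x.1 = y)
    (C : CompatibleCoefficientFields f h) (σ : decompositionGroup f x)
    (hσ : σ ∈ inertiaGroup f x) (a : ResidueField (X.presheaf.stalk x.1)) :
    completedMap (stalkAut σ : _ →+* X.presheaf.stalk x.1) (C.top a) = C.top a := by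
  let := (residueMap f h).toAlgebra
  have := isAlgebraic_residueMap f h
  have hσY : ((stalkAut σ : _ →+* X.presheaf.stalk x.1)).comp (localMap f h) = localMap f h := by
    refine RingHom.ext fun b => algebraMap_stalk_injective (f := f) ?_
    refine (algebraMap_stalkAut σ _).trans ?_
    exact (congrArg _ (algebraMap_localMap f h b).symm).trans
      (((σ : CoverGroup f).commutes _).trans (algebraMap_localMap f h b))
  have key := ringHom_eq_of_sub_mem_maximalIdeal (κ₀ := ResidueField (Y.presheaf.stalk y)) C.top
    ((completedMap (stalkAut σ : _ →+* X.presheaf.stalk x.1)).comp C.top) (fun b => by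
      have hb := RingHom.congr_fun C.comm b
      change completedMap _ (C.top (residueMap f h b)) = C.top (residueMap f h b)
      change C.top (residueMap f h b) = _ at hb
      rw [hb]
      exact completedMap_completedMap _ _ _ hσY _) (fun b => by
      have hb : completedResidue _ (C.top b) = b := RingHom.congr_fun C.top_section b
      rw [← completedResidue_eq_zero_iff, map_sub, RingHom.comp_apply,
        completedResidue_completedMap, hb, sub_eq_zero]
      exact (mem_inertiaGroup_iff σ).mp hσ b)
  exact RingHom.congr_fun key a

variable {X Y Z W : Scheme.{u}} [IsRegularCurve X] [IsRegularCurve W]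

/-- `𝒪_{X,x}` is the intersection of `k(X)` with the local ring at a point above `x`. -/
lemma functionFieldMap_mem_localValuationSubring_iff {f : X ⟶ Y} {q : W ⟶ Z} (p : W ⟶ X)
    [IsDominant p] {x : ClosedPoint X} {w : ClosedPoint W} (h : p w.1 = x.1)
    (a : X.functionField) :
    (functionFieldMap p a : CoverField q) ∈ localValuationSubring q w ↔
      (a : CoverField f) ∈ localValuationSubring f x := by
  constructor
  · intro ha
    rcases (localValuationSubring f x).mem_or_inv_mem a with ha' | ha'
    · exact ha'
    obtain ⟨b, hb⟩ := (mem_localValuationSubring f x _).mp ha'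
    obtain ⟨c, hc⟩ := (mem_localValuationSubring q w _).mp ha
    rcases eq_or_ne a 0 with rfl | ha0
    · exact zero_mem _
    have hu : IsUnit (localMap p h b) := by
      refine IsUnit.of_mul_eq_one c (algebraMap_stalk_injective (f := q) ?_)
      rw [map_mul, hc]
      refine (congrArg (· * _) (algebraMap_localMap p h b).symm).trans ?_
      refine (map_mul (functionFieldMap p) _ _).symm.trans ?_
      have : (algebraMap (X.presheaf.stalk x.1) X.functionField b) = a⁻¹ := hb
      rw [this, inv_mul_cancel₀ ha0, map_one, map_one]
      rfl
    obtain ⟨v, rfl⟩ := isUnit_of_map_unit (localMap p h) b hu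
    refine (mem_localValuationSubring f x _).mpr ⟨((v⁻¹ : _ˣ) : _), ?_⟩
    rw [map_units_inv, hb]
    exact inv_inv (a : X.functionField)
  · intro ha
    obtain ⟨b, rfl⟩ := (mem_localValuationSubring f x _).mp ha
    exact (mem_localValuationSubring q w _).mpr ⟨localMap p h b, (algebraMap_localMap p h b).symm⟩

end Covers

/-! ### Lifting and restricting elements of decomposition groups -/

section Core

open IsLocalRing

lemma exists_eq_algebraMap_add_pow_mul_completedRing {R : Type u} [CommRing R] [IsDomain R]
    [IsDiscreteValuationRing R] {ϖ : R} (hϖ : Irreducible ϖ) (x : CompletedRing R) (n : ℕ) :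
    ∃ (r : R) (y : CompletedRing R),
      x = algebraMap R (CompletedRing R) r + algebraMap R (CompletedRing R) ϖ ^ n * y := by
  obtain ⟨r, hr⟩ := exists_sub_algebraMap_mem_maximalIdeal_pow x n
  rw [maximalIdeal_completedRing_eq_span hϖ, Ideal.span_singleton_pow,
    Ideal.mem_span_singleton] at hr
  obtain ⟨y, hy⟩ := hr
  exact ⟨r, y, by rw [← hy]; ring⟩

lemma algebraMap_algebraMap_completedField_injective (R : Type u) [CommRing R] [IsDomain R]
    [IsDiscreteValuationRing R] : Function.Injective
      ((algebraMap (CompletedRing R) (CompletedField R)).comp (algebraMap R (CompletedRing R))) :=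
  (IsFractionRing.injective (CompletedRing R) (CompletedField R)).comp
    (algebraMap_completedRing_injective R)

/-- A homomorphism `QF(Ŝ) → QF(R̂)` over `O` restricts to a homomorphism of fields `M → QF(R̂)` over
the fraction field of `O`. -/
lemma exists_algHom_completedField {O R S : Type u} [CommRing O] [IsDomain O] [CommRing R]
    [IsDomain R] [IsDiscreteValuationRing R] [CommRing S] [IsDomain S] [IsDiscreteValuationRing S]
    {K L M : Type*} [Field K] [Field L] [Field M] [Algebra O K] [IsFractionRing O K] [Algebra R L]
    [Algebra S M] [IsFractionRing S M] [Algebra K L] [Algebra K M]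
    (cR : O →+* R) (cS : O →+* S)
    (hR : ∀ o, algebraMap K L (algebraMap O K o) = algebraMap R L (cR o))
    (hS : ∀ o, algebraMap K M (algebraMap O K o) = algebraMap S M (cS o))
    (ι : CompletedField S →+* CompletedField R)
    (hι : ∀ o, ι (algebraMap (CompletedRing S) _ (algebraMap S _ (cS o))) =
      algebraMap (CompletedRing R) _ (algebraMap R _ (cR o)))
    [Algebra K (CompletedField R)] [Algebra L (CompletedField R)]
    [IsScalarTower K L (CompletedField R)]
    (hL : ∀ r, algebraMap L (CompletedField R) (algebraMap R L r) =
      algebraMap (CompletedRing R) _ (algebraMap R _ r)) :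
    ∃ j : M →ₐ[K] CompletedField R, ∀ s, j (algebraMap S M s) =
      ι (algebraMap (CompletedRing S) _ (algebraMap S _ s)) := by
  let φ : M →+* CompletedField S := IsFractionRing.lift
    (algebraMap_algebraMap_completedField_injective S)
  have hφ : ∀ s, φ (algebraMap S M s) = algebraMap (CompletedRing S) _ (algebraMap S _ s) :=
    fun s => IsFractionRing.lift_algebraMap _ s
  have hK : (ι.comp φ).comp (algebraMap K M) = algebraMap K (CompletedField R) := by
    refine IsLocalization.ringHom_ext (nonZeroDivisors O) (RingHom.ext fun o => ?_)
    simp only [RingHom.comp_apply]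
    rw [hS, hφ, hι, IsScalarTower.algebraMap_apply K L (CompletedField R), hR, hL]
  exact ⟨{ ι.comp φ with commutes' := fun a => RingHom.congr_fun hK a },
    fun s => congrArg ι (hφ s)⟩

lemma localMap_injective {X Y : Scheme.{u}} [IsIntegral X] [IsIntegral Y] (f : X ⟶ Y)
    [IsDominant f] {x : X} {y : Y} (h : f x = y) : Function.Injective (localMap f h) := by
  intro a b hab
  apply IsFractionRing.injective (Y.presheaf.stalk y) Y.functionField
  apply (functionFieldMap f).injective
  rw [algebraMap_localMap f h, algebraMap_localMap f h, hab]

variable {X Y Z W : Scheme.{u}} [IsRegularCurve X] [IsRegularCurve Y] [IsRegularCurve Z]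
  [IsRegularCurve W]

/-- Let `k(W)` be a compositum of the Galois extensions `k(X)` and `k(Z)` of `k(Y)`, and suppose
that `QF(𝒪̂_{Z,z})` embeds into `QF(𝒪̂_{X,x})` over `𝒪̂_{Y,τ}`.  Then `k(W)` embeds into
`QF(𝒪̂_{X,x})` compatibly with the valuations, so that `k(w) = k(x)`, and an element of the
decomposition group at `x` is the restriction of an element of the decomposition group at `w` if
and only if it is trivial on the image of `QF(𝒪̂_{Z,z})`. -/
theorem residueMap_surjective_and_exists_lift_iff (Φ : X ⟶ Y) [IsGaloisCover Φ]
    (Ψ : Z ⟶ Y) [IsGaloisCover Ψ] (p : W ⟶ X) [IsDominant p] (q : W ⟶ Z) [IsDominant q]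
    (hsq : p ≫ Φ = q ≫ Ψ)
    (hgen : ∀ F₀ : Subfield W.functionField, (∀ a, functionFieldMap p a ∈ F₀) →
        (∀ a, functionFieldMap q a ∈ F₀) → F₀ = ⊤)
    {x : ClosedPoint X} {z : ClosedPoint Z} {τ : Y} (hx : Φ x.1 = τ) (hz : Ψ z.1 = τ)
    {w : ClosedPoint W} (hwx : p w.1 = x.1)
    (ι : CompletedField (Z.presheaf.stalk z.1) →+* CompletedField (X.presheaf.stalk x.1))
    (hι : ∀ a : CompletedRing (Y.presheaf.stalk τ),
      ι (algebraMap _ _ (completedMap (localMap Ψ hz) a)) =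
        algebraMap _ _ (completedMap (localMap Φ hx) a)) :
    Function.Surjective (residueMap p hwx) ∧
    ∀ n : decompositionGroup Φ x,
      (∃ σ : decompositionGroup q w, ∀ a : X.functionField,
        (σ : CoverGroup q) (functionFieldMap p a) =
          functionFieldMap p ((n : CoverGroup Φ) a)) ↔ ∀ y, completedAut n (ι y) = ι y := by
  have hpΦ : IsDominant (p ≫ Φ) := inferInstance
  have hτ : IsClosed ({τ} : Set Y) := by
    have := Φ.isClosedMap _ x.2
    rwa [Set.image_singleton, hx] at this
  have hO : IsDiscreteValuationRing (Y.presheaf.stalk τ) :=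
    IsRegularCurve.isDiscreteValuationRing ⟨τ, hτ⟩
  -- the tower of function fields
  let : Algebra Y.functionField Z.functionField := (functionFieldMap Ψ).toAlgebra
  let : Algebra Y.functionField (CoverField q) :=
    ((functionFieldMap q).comp (functionFieldMap Ψ)).toAlgebra
  let : Algebra (CoverField Φ) (CoverField q) := (functionFieldMap p).toAlgebra
  have : IsScalarTower Y.functionField Z.functionField (CoverField q) := .of_algebraMap_eq' rfl
  have : IsScalarTower Y.functionField (CoverField Φ) (CoverField q) := .of_algebraMap_eq fun a =>
    (functionFieldMap_comp q Ψ _ hsq a).symm.trans (functionFieldMap_comp p Φ _ rfl a)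
  have : IsGalois Y.functionField (CoverField Φ) := IsGaloisCover.isGalois
  have : IsGalois Y.functionField Z.functionField := IsGaloisCover.isGalois (f := Ψ)
  have : FiniteDimensional Y.functionField Z.functionField := finiteDimensional_coverField Ψ
  have hLM : IntermediateField.adjoin (CoverField Φ)
      (Set.range (algebraMap Z.functionField (CoverField q))) = ⊤ :=
    adjoin_range_eq_top_of_forall_subfield hgen
  have hML : IntermediateField.adjoin Z.functionField
      (Set.range (algebraMap (CoverField Φ) (CoverField q))) = ⊤ :=
    adjoin_range_eq_top_of_forall_subfield fun F₀ hq hp => hgen F₀ hp hq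
  -- the local rings
  let R := X.presheaf.stalk x.1
  let S := Z.presheaf.stalk z.1
  let Ω := CompletedField R
  let : Algebra R (CoverField q) :=
    ((algebraMap (CoverField Φ) (CoverField q)).comp (algebraMap R (CoverField Φ))).toAlgebra
  have : IsScalarTower R (CoverField Φ) (CoverField q) := .of_algebraMap_eq' rfl
  let : Algebra (CoverField Φ) Ω :=
    (IsFractionRing.lift (K := CoverField Φ)
      (algebraMap_algebraMap_completedField_injective R)).toAlgebra
  let : Algebra Y.functionField Ω :=
    ((algebraMap (CoverField Φ) Ω).comp (algebraMap Y.functionField (CoverField Φ))).toAlgebra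
  have : IsScalarTower Y.functionField (CoverField Φ) Ω := .of_algebraMap_eq' rfl
  have hL : ∀ r : R, algebraMap (CoverField Φ) Ω (algebraMap R (CoverField Φ) r) =
      algebraMap (CompletedRing R) Ω (algebraMap R (CompletedRing R) r) :=
    fun r => IsFractionRing.lift_algebraMap _ r
  have hRF : ∀ r : R, algebraMap R (CoverField q) r =
      algebraMap (W.presheaf.stalk w.1) (CoverField q) (localMap p hwx r) :=
    fun r => algebraMap_localMap p hwx r
  obtain ⟨j, hj⟩ := exists_algHom_completedField (O := Y.presheaf.stalk τ) (R := R) (S := S)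
    (K := Y.functionField) (L := CoverField Φ) (M := Z.functionField)
    (localMap Φ hx) (localMap Ψ hz) (algebraMap_localMap Φ hx) (algebraMap_localMap Ψ hz) ι
    (fun o => by
      have := hι (algebraMap _ _ o)
      rwa [completedMap_algebraMap, completedMap_algebraMap] at this) hL
  obtain ⟨e, he⟩ := exists_algHom_mem_range_iff (R := R) (S := CompletedRing R)
    (V := localValuationSubring q w) j hLM (algebraMap R (CompletedRing R)) hL
    (fun r => (mem_localValuationSubring q w _).mpr ⟨_, (hRF r).symm⟩)
    (fun r hr => by
      rw [hRF]
      refine algebraMap_mem_nonunits ?_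
      intro hu
      exact hr (isUnit_of_map_unit _ _ hu))
  obtain ⟨ϖ, hϖ⟩ := IsDiscreteValuationRing.exists_irreducible R
  have hd := exists_eq_algebraMap_add_pow_mul_completedRing hϖ
  let e₁ : Z.functionField →ₐ[Y.functionField] Ω :=
    (e.restrictScalars Y.functionField).comp
      (IsScalarTower.toAlgHom Y.functionField Z.functionField (CoverField q))
  -- by normality, `e` and `j` map `k(Z)` onto the same subfield
  refine ⟨fun b => ?_, fun n => ⟨fun ⟨σ, hσn⟩ y => ?_, fun hn => ?_⟩⟩
  -- `𝒪_{X,x}` is dense in its completion, and hence in the intermediate ring `𝒪_{W,w}`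
  · obtain ⟨b, rfl⟩ := residue_surjective b
    obtain ⟨r, g, hg, hrg⟩ := exists_eq_algebraMap_add_pow_mul e he
      (algebraMap R (CompletedRing R)) hL hϖ hd
      ((mem_localValuationSubring q w (algebraMap _ (CoverField q) b)).mpr ⟨b, rfl⟩) 1
    obtain ⟨g, rfl⟩ := (mem_localValuationSubring q w _).mp hg
    rw [hRF, hRF, pow_one, ← map_mul, ← map_add] at hrg
    have hb := algebraMap_stalk_injective hrg
    refine ⟨residue _ r, ?_⟩
    rw [hb, map_add, map_mul, (residue_eq_zero_iff (localMap p hwx ϖ)).mpr fun hu =>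
      hϖ.not_isUnit (isUnit_of_map_unit _ _ hu), zero_mul, add_zero]
    rfl
  -- `completedAut n` and `σ` agree on `k(W)`, as they agree on the dense subring `𝒪_{X,x}`
  · have hβ : ∀ f, completedAut n (e f) = e ((σ : CoverGroup q) f) :=
      map_algHom_eq_of_dense e he (algebraMap R (CompletedRing R)) hL hϖ hd
        (σ : CoverGroup q).toRingEquiv
        (fun f hf => ((mem_decompositionGroup_iff _).mp σ.2 f).mpr hf)
        (stalkAut n) (fun r => (hσn _).trans
          (congrArg (functionFieldMap p) (algebraMap_stalkAut n r).symm))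
        (completedAut n : Ω →+* Ω) (fun a => ⟨_, (completedAut_algebraMap n a).symm⟩)
        (completedAut_algebraMap_algebraMap n)
    have hj' : ∀ m, completedAut n (j m) = j m := by
      intro m
      obtain ⟨m', hm'⟩ := mem_range_of_normal e₁ j m
      rw [← hm']
      exact (hβ _).trans (congrArg e ((σ : CoverGroup q).commutes m'))
    obtain ⟨o, ho⟩ := IsDiscreteValuationRing.exists_irreducible (Y.presheaf.stalk τ)
    refine map_eq_of_forall_map_algebraMap_eq ι (a := algebraMap _ _ (localMap Ψ hz o))
      (b := algebraMap _ _ (localMap Φ hx o)) ?_ ?_ ?_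
      (stalkAut n : R →+* R) (completedAut n : Ω →+* Ω) (completedAut_algebraMap n) (fun s => ?_) y
    · rw [Ne, map_eq_zero_iff _ (algebraMap_completedRing_injective S),
        map_eq_zero_iff _ (localMap_injective Ψ hz)]
      exact ho.ne_zero
    · rw [← completedRing_map_maximalIdeal]
      exact Ideal.mem_map_of_mem _ fun hu => ho.not_isUnit (isUnit_of_map_unit _ _ hu)
    · rw [← completedMap_algebraMap, hι, completedMap_algebraMap]
    · rw [← hj]
      exact hj' _
  -- `n` preserves the image of `k(W)`, as it preserves that of `k(X)` and fixes that of `k(Z)`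
  · have hβL : ∀ l : CoverField Φ, completedAut n (algebraMap (CoverField Φ) Ω l) =
        algebraMap (CoverField Φ) Ω ((n : CoverGroup Φ) l) := by
      intro l
      obtain ⟨a, b, -, rfl⟩ := IsFractionRing.div_surjective R l
      have hn' : ∀ r : R, algebraMap (CoverField Φ) Ω ((n : CoverGroup Φ) (algebraMap R _ r)) =
          algebraMap (CompletedRing R) Ω (algebraMap R _ (stalkAut n r)) := fun r =>
        (congrArg _ (algebraMap_stalkAut n r).symm).trans (hL _)
      rw [map_div₀, map_div₀, map_div₀, map_div₀, hL, hL, hn', hn',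
        completedAut_algebraMap_algebraMap, completedAut_algebraMap_algebraMap]
    have hβM : ∀ m : Z.functionField, completedAut n (e (algebraMap _ (CoverField q) m)) =
        e (algebraMap _ (CoverField q) m) := by
      intro m
      obtain ⟨m', hm'⟩ := mem_range_of_normal j e₁ m
      change completedAut n (e₁ m) = e₁ m
      rw [← hm']
      obtain ⟨a, b, -, rfl⟩ := IsFractionRing.div_surjective S m'
      change completedAut n (j _) = j _
      rw [map_div₀, map_div₀, hj, hj, hn, hn]
    obtain ⟨σ, hσ⟩ := exists_algEquiv_of_fixes (K := Y.functionField) hLM hML e (completedAut n)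
      (fun l => ⟨_, (hβL l).symm⟩) hβM
    refine ⟨⟨σ, (mem_decompositionGroup_iff _).mpr fun a => ?_⟩, fun a => ?_⟩
    · rw [← he, ← he, hσ]
      constructor
      · rintro ⟨b, hb⟩
        obtain ⟨b, rfl⟩ := (completedEquiv (stalkAut n)).surjective b
        exact ⟨b, (completedAut n).injective ((completedAut_algebraMap n b).trans hb)⟩
      · rintro ⟨b, hb⟩
        exact ⟨_, by rw [← hb, completedAut_algebraMap]⟩
    · apply e.toRingHom.injective
      refine (hσ _).trans ?_
      refine (congrArg _ (e.commutes a)).trans ?_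
      exact (hβL a).trans (e.commutes _).symm

end Core

/-! ### Actions on residue fields -/

section Residue

open IsLocalRing

variable {X Y Z W : Scheme.{u}}

/-- An element of the decomposition group at `w` restricts to one of the decomposition group at `x`,
as `k(X)` is normal over `k(Y)`. -/
lemma exists_restrict [IsRegularCurve X] [IsRegularCurve W] [IsIntegral Y] [IsIntegral Z]
    (Φ : X ⟶ Y) [IsGaloisCover Φ] (Ψ : Z ⟶ Y) [IsDominant Ψ]
    (p : W ⟶ X) [IsDominant p] (q : W ⟶ Z) [IsDominant q] (hsq : p ≫ Φ = q ≫ Ψ)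
    {x : ClosedPoint X} {w : ClosedPoint W} (hwx : p w.1 = x.1) (σ : decompositionGroup q w) :
    ∃ n : decompositionGroup Φ x, ∀ a : X.functionField,
      (σ : CoverGroup q) (functionFieldMap p a) = functionFieldMap p ((n : CoverGroup Φ) a) := by
  have hpΦ : IsDominant (p ≫ Φ) := inferInstance
  let : Algebra Y.functionField Z.functionField := (functionFieldMap Ψ).toAlgebra
  let : Algebra Y.functionField (CoverField q) :=
    ((functionFieldMap q).comp (functionFieldMap Ψ)).toAlgebra
  let : Algebra (CoverField Φ) (CoverField q) := (functionFieldMap p).toAlgebra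
  have : IsScalarTower Y.functionField Z.functionField (CoverField q) := .of_algebraMap_eq' rfl
  have : IsScalarTower Y.functionField (CoverField Φ) (CoverField q) := .of_algebraMap_eq fun a =>
    (functionFieldMap_comp q Ψ _ hsq a).symm.trans (functionFieldMap_comp p Φ _ rfl a)
  have : IsGalois Y.functionField (CoverField Φ) := IsGaloisCover.isGalois
  let n : CoverGroup Φ :=
    ((σ : CoverGroup q).restrictScalars Y.functionField).restrictNormal (CoverField Φ)
  have hn : ∀ a : CoverField Φ, (σ : CoverGroup q) (functionFieldMap p a) =
      functionFieldMap p (n a) := fun a =>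
    (AlgEquiv.restrictNormal_commutes ((σ : CoverGroup q).restrictScalars Y.functionField)
      (CoverField Φ) a).symm
  refine ⟨⟨n, (mem_decompositionGroup_iff n).mpr fun a => ?_⟩, hn⟩
  refine (functionFieldMap_mem_localValuationSubring_iff (q := q) p hwx (n a)).symm.trans
    (Iff.trans ?_ (functionFieldMap_mem_localValuationSubring_iff (q := q) p hwx a))
  rw [← hn]
  exact (mem_decompositionGroup_iff _).mp σ.2 _

lemma residueAut_residueMap [IsRegularCurve X] [IsRegularCurve W] [IsIntegral Y] [IsIntegral Z]
    {Φ : X ⟶ Y} [IsDominant Φ] (p : W ⟶ X) [IsDominant p] {q : W ⟶ Z} [IsDominant q]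
    {x : ClosedPoint X} {w : ClosedPoint W} (hwx : p w.1 = x.1) (σ : decompositionGroup q w)
    (n : decompositionGroup Φ x) (h : ∀ a : X.functionField,
      (σ : CoverGroup q) (functionFieldMap p a) = functionFieldMap p ((n : CoverGroup Φ) a))
    (a : ResidueField (X.presheaf.stalk x.1)) :
    residueAut σ (residueMap p hwx a) = residueMap p hwx (residueAut n a) := by
  obtain ⟨a, rfl⟩ := residue_surjective a
  have : stalkAut σ (localMap p hwx a) = localMap p hwx (stalkAut n a) := by
    apply algebraMap_stalk_injective (f := q)
    rw [algebraMap_stalkAut]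
    refine (congrArg _ (algebraMap_localMap p hwx a).symm).trans ?_
    exact (h _).trans ((congrArg (functionFieldMap p) (algebraMap_stalkAut n a).symm).trans
      (algebraMap_localMap p hwx _))
  exact congrArg (residue _) this

/-- The decomposition group of a cover acts on the residue field over that of the base. -/
lemma residueAut_residueMap_base [IsRegularCurve W] [IsIntegral Z] {q : W ⟶ Z} [IsDominant q]
    {w : ClosedPoint W} {z : Z} (hwz : q w.1 = z) (σ : decompositionGroup q w)
    (a : ResidueField (Z.presheaf.stalk z)) :
    residueAut σ (residueMap q hwz a) = residueMap q hwz a := by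
  obtain ⟨a, rfl⟩ := residue_surjective a
  have : stalkAut σ (localMap q hwz a) = localMap q hwz a := by
    apply algebraMap_stalk_injective (f := q)
    rw [algebraMap_stalkAut]
    refine (congrArg _ (algebraMap_localMap q hwz a).symm).trans ?_
    exact ((σ : CoverGroup q).commutes _).trans (algebraMap_localMap q hwz a)
  exact congrArg (residue _) this

lemma residueMap_comp (f : X ⟶ Y) (g : Y ⟶ Z) (h : X ⟶ Z) (hfg : h = f ≫ g) {x : X} {y : Y}
    {z : Z} (hxy : f x = y) (hyz : g y = z) (hxz : h x = z)
    (a : ResidueField (Z.presheaf.stalk z)) :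
    residueMap h hxz a = residueMap f hxy (residueMap g hyz a) := by
  obtain ⟨a, rfl⟩ := residue_surjective a
  exact congrArg (residue _) (localMap_comp f g h hfg hxy hyz hxz a)

/-- The decomposition group of a Galois cover surjects onto the automorphism group of the residue
field extension. -/
lemma exists_residueAut_eq [IsRegularCurve Z] [IsRegularCurve W] (q : W ⟶ Z) [IsGaloisCover q]
    {w : ClosedPoint W} {z : ClosedPoint Z} (hwz : q w.1 = z.1)
    (θ : ResidueField (W.presheaf.stalk w.1) ≃+* ResidueField (W.presheaf.stalk w.1))
    (hθ : ∀ a, θ (residueMap q hwz a) = residueMap q hwz a) :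
    ∃ σ : decompositionGroup q w, ∀ a, residueAut σ a = θ a := by
  let V := localValuationSubring q w
  let S := Z.presheaf.stalk z.1
  have : IsGalois Z.functionField (CoverField q) := IsGaloisCover.isGalois
  let : Algebra S (CoverField q) :=
    ((algebraMap Z.functionField (CoverField q)).comp (algebraMap S Z.functionField)).toAlgebra
  have : IsScalarTower S Z.functionField (CoverField q) := .of_algebraMap_eq' rfl
  have hSF : ∀ s : S, algebraMap S (CoverField q) s =
      stalkEquiv q w (localMap q hwz s) := fun s => algebraMap_localMap q hwz s
  have hV : ∀ s : S, algebraMap S (CoverField q) s ∈ V := fun s => hSF s ▸ SetLike.coe_mem _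
  have hm : ∀ s ∈ maximalIdeal S, algebraMap S (CoverField q) s ∈ V.nonunits := fun s hs => by
    rw [hSF]
    exact algebraMap_mem_nonunits fun hu => hs (isUnit_of_map_unit _ _ hu)
  let ε := ResidueField.mapEquiv (stalkEquiv q w)
  have hε : ∀ b, ε (residue _ b) = residue _ (stalkEquiv q w b) := fun _ => rfl
  obtain ⟨g, hgV, hg⟩ := exists_algEquiv_residue_eq (L := Z.functionField) hV hm
    ((ε.symm.trans θ).trans ε) (fun s => by
      have hs : (⟨algebraMap S (CoverField q) s, hV s⟩ : V) =
        stalkEquiv q w (localMap q hwz s) := Subtype.ext (hSF s)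
      rw [hs, ← hε]
      have := hθ (residue _ s)
      simp only [RingEquiv.trans_apply, RingEquiv.symm_apply_apply]
      exact congrArg ε this)
  refine ⟨⟨g, (mem_decompositionGroup_iff g).mpr hgV⟩, fun a => ?_⟩
  obtain ⟨a, rfl⟩ := residue_surjective a
  rw [residueAut_residue]
  apply ε.injective
  rw [hε, hg (stalkEquiv q w a) _ (algebraMap_stalkAut _ a), ← hε]
  simp

end Residue

end CoverInertia

end

theorem mainTheorem4
    -- regular `k`-curves and Galois covers `Φ : X ⟶ Y`, `Ψ : Z ⟶ Y`
    {k : Type u} [Field k] {X Y Z : Scheme.{u}}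
    [IsRegularCurve X] [IsRegularCurve Y] [IsRegularCurve Z]
    (s : Y ⟶ Spec (CommRingCat.of k)) [LocallyOfFiniteType s]
    (Φ : X ⟶ Y) [IsGaloisCover Φ] (Ψ : Z ⟶ Y) [IsGaloisCover Ψ]
    -- closed points `x` and `z` above `τ`, with `k(z) = k(τ)`
    (x : ClosedPoint X) (z : ClosedPoint Z) (τ : Y)
    (hx : Φ x.1 = τ) (hz : Ψ z.1 = τ)
    (hκ : Function.Bijective (residueMap Ψ hz))
    -- a normal subgroup `N` of the decomposition group at `x`, contained in the inertia group
    (N : Subgroup (decompositionGroup Φ x)) [N.Normal] (hN : N ≤ inertiaGroup Φ x)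
    -- `QF(𝒪̂_{X,x})^N` is the compositum of `QF(𝒪̂_{Z,z})` (embedded over `𝒪̂_{Y,τ}`) and `k(x)`
    (C : CompatibleCoefficientFields Φ hx)
    (ι : CompletedField (Z.presheaf.stalk z.1) →+* CompletedField (X.presheaf.stalk x.1))
    (hι : ∀ a : CompletedRing (Y.presheaf.stalk τ),
      ι (algebraMap _ _ (completedMap (localMap Ψ hz) a)) =
        algebraMap _ _ (completedMap (localMap Φ hx) a))
    (hfix : completedFixedField N =
      ι.fieldRange ⊔ ((algebraMap (CompletedRing (X.presheaf.stalk x.1))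
        (CompletedField (X.presheaf.stalk x.1))).comp C.top).fieldRange)
    -- an irreducible component `W` of the normalization of `X ×_Y Z`, dominating `Y`
    (W : Scheme.{u}) (ν : W ⟶ pullback Φ Ψ) (hν : IsComponentOfNormalization ν)
    (hdom : IsDominant (ν ≫ pullback.fst Φ Ψ ≫ Φ))
    (p : W ⟶ X) (hp : p = ν ≫ pullback.fst Φ Ψ)
    (q : W ⟶ Z) (hq : q = ν ≫ pullback.snd Φ Ψ)
    -- a closed point `w` of `W` above `(x, z)`
    (w : ClosedPoint W) (hwx : p w.1 = x.1) (hwz : q w.1 = z.1) :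
    ∃ (_ : IsRegularCurve W) (_ : IsDominant p) (_ : IsGaloisCover q)
      (E : GroupExtension N (decompositionGroup q w) (ResidueGal Φ hx)),
      E.inl.range = inertiaGroup q w ∧
      (∀ (n : N) (a : X.functionField),
        ((E.inl n : decompositionGroup q w) : CoverGroup q) (functionFieldMap p a) =
          functionFieldMap p (((n : decompositionGroup Φ x) : CoverGroup Φ) a)) ∧
      (∀ (σ : decompositionGroup q w)
        (a : IsLocalRing.ResidueField (X.presheaf.stalk x.1)),
        residueMap p hwx (E.rightHom σ a) = residueAut σ (residueMap p hwx a)) := by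
  obtain ⟨_, _, _, hgen⟩ := isGaloisCover_component s Φ Ψ ν hν hdom p hp q hq
  have hsq : p ≫ Φ = q ≫ Ψ := by simp [hp, hq, pullback.condition]
  obtain ⟨hsurj, hlift_iff⟩ :=
    residueMap_surjective_and_exists_lift_iff Φ Ψ p q hsq hgen hx hz hwx ι hι
  have hinj : Function.Injective (functionFieldMap p) := (functionFieldMap p).injective
  -- automorphisms over `k(Z)` are determined by their restriction to `k(X)`
  have hext : ∀ σ σ' : decompositionGroup q w, (∀ a : X.functionField,
      (σ : CoverGroup q) (functionFieldMap p a) = (σ' : CoverGroup q) (functionFieldMap p a)) →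
      σ = σ' := by
    intro σ σ' h
    refine Subtype.ext (AlgEquiv.ext fun a => ?_)
    let F₀ : Subfield (CoverField q) :=
      ((σ : CoverGroup q) : CoverField q →+* CoverField q).eqLocusField
        ((σ' : CoverGroup q) : CoverField q →+* CoverField q)
    have htop : F₀ = ⊤ := hgen F₀ h fun b =>
      ((σ : CoverGroup q).commutes b).trans ((σ' : CoverGroup q).commutes b).symm
    have ha : a ∈ F₀ := htop ▸ Subfield.mem_top a
    exact ha
  -- the isomorphism `k(x) ≃ k(w)`
  let ρ := RingEquiv.ofBijective (residueMap p hwx) ⟨(residueMap p hwx).injective, hsurj⟩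
  have hbase : ∀ c, ρ (residueMap Φ hx c) = residueMap q hwz (residueMap Ψ hz c) := fun c =>
    (residueMap_comp p Φ (p ≫ Φ) rfl hwx hx (by rw [Scheme.Hom.comp_apply, hwx, hx]) c).symm.trans
      (residueMap_comp q Ψ (p ≫ Φ) hsq hwz hz _ c)
  -- elements of `N` lift, since they fix the image of `QF(𝒪̂_{Z,z})`
  have hNι : ∀ n ∈ N, ∀ y, completedAut n (ι y) = ι y := fun n hn y =>
    (mem_completedFixedField N _).mp (hfix.symm.le.trans' le_sup_left ⟨y, rfl⟩)
      n hn
  choose lift hlift using fun n : N => (hlift_iff n).mpr (hNι n n.2)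
  -- conversely, the restriction of an element of the inertia group fixes `QF(𝒪̂_{Z,z})` and the
  -- coefficient field, hence `QF(𝒪̂_{X,x})^N`, and lies in `N` by Artin's theorem
  have hinertia : ∀ σ : decompositionGroup q w, σ ∈ inertiaGroup q w → ∃ n : N, lift n = σ := by
    intro σ hσ
    obtain ⟨n, hn⟩ := exists_restrict Φ Ψ p q hsq hwx σ
    have hnI : n ∈ inertiaGroup Φ x := (mem_inertiaGroup_iff n).mpr fun a =>
      (residueMap p hwx).injective <| by
        rw [← residueAut_residueMap p hwx σ n hn, (mem_inertiaGroup_iff σ).mp hσ]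
    have hnN : n ∈ N := by
      refine mem_of_forall_completedFixedField N n ?_
      have hle : ι.fieldRange ⊔ ((algebraMap (CompletedRing (X.presheaf.stalk x.1))
          (CompletedField (X.presheaf.stalk x.1))).comp C.top).fieldRange ≤
          (completedAut n).toRingHom.eqLocusField (RingHom.id _) := by
        refine sup_le ?_ ?_
        · rintro _ ⟨y, rfl⟩
          exact (hlift_iff n).mp ⟨σ, hn⟩ y
        · rintro _ ⟨a, rfl⟩
          exact (completedAut_algebraMap n _).trans
            (congrArg _ (completedMap_stalkAut_top hx C n hnI a))
      exact fun a ha => hle (hfix ▸ ha)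
    exact ⟨⟨n, hnN⟩, hext _ _ fun a => (hlift _ a).trans (hn a).symm⟩
  have hliftI : ∀ n : N, lift n ∈ inertiaGroup q w := fun n =>
    (mem_inertiaGroup_iff _).mpr fun a => by
      obtain ⟨a, rfl⟩ := hsurj a
      rw [residueAut_residueMap p hwx (lift n) n.1 (hlift n), (mem_inertiaGroup_iff _).mp (hN n.2)]
  let inl : N →* decompositionGroup q w := MonoidHom.mk' lift fun m n => hext _ _ fun a => by
    rw [hlift]
    refine Eq.symm ((congrArg (lift m : CoverGroup q) (hlift n a)).trans ?_)
    exact hlift m _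
  have hinlI : inl.range = inertiaGroup q w := by
    ext σ
    constructor
    · rintro ⟨n, rfl⟩
      exact hliftI n
    · exact hinertia σ
  let _ := (residueMap Φ hx).toAlgebra
  let rightHom : decompositionGroup q w →* ResidueGal Φ hx := MonoidHom.mk'
    (fun σ => AlgEquiv.ofRingEquiv (f := (ρ.trans (residueAut σ)).trans ρ.symm) fun c => by
      change ρ.symm (residueAut σ (ρ (residueMap Φ hx c))) = residueMap Φ hx c
      rw [RingEquiv.symm_apply_eq, hbase, residueAut_residueMap_base])
    (fun σ σ' => AlgEquiv.ext fun a => by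
      change ρ.symm (residueAut (σ * σ') (ρ a)) =
        ρ.symm (residueAut σ (ρ (ρ.symm (residueAut σ' (ρ a)))))
      rw [RingEquiv.apply_symm_apply, residueAut_mul])
  have hright : ∀ σ a, ρ (rightHom σ a) = residueAut σ (ρ a) := fun σ a =>
    ρ.apply_symm_apply _
  refine ⟨‹_›, ‹_›, ‹_›, ⟨inl, rightHom, ?_, ?_, ?_⟩, hinlI, hlift, hright⟩
  · intro m n hmn
    refine Subtype.ext (Subtype.ext (AlgEquiv.ext fun a => hinj ?_))
    exact (hlift m a).symm.trans ((congrArg (fun σ : decompositionGroup q w =>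
      (σ : CoverGroup q) (functionFieldMap p a)) hmn).trans (hlift n a))
  · rw [hinlI]
    ext σ
    rw [mem_inertiaGroup_iff, MonoidHom.mem_ker]
    constructor
    · intro h
      refine AlgEquiv.ext fun a => ρ.injective ?_
      rw [hright, h]
      rfl
    · intro h a
      obtain ⟨a, rfl⟩ := ρ.surjective a
      rw [← hright, h]
      rfl
  · intro θ
    obtain ⟨σ, hσ⟩ := exists_residueAut_eq q hwz ((ρ.symm.trans θ.toRingEquiv).trans ρ)
      (fun b => by
        obtain ⟨c, rfl⟩ := hκ.2 b
        have := θ.commutes c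
        change θ (residueMap Φ hx c) = residueMap Φ hx c at this
        rw [← hbase]
        change ρ (θ (ρ.symm (ρ _))) = _
        rw [RingEquiv.symm_apply_apply, this])
    refine ⟨σ, AlgEquiv.ext fun a => ρ.injective ?_⟩
    rw [hright, hσ]
    change ρ (θ (ρ.symm (ρ a))) = _
    rw [RingEquiv.symm_apply_apply]
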